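/- Let $d\ge 1$, let $\Omega=[0,1]^d$, let $1\le p,q\le\infty$, and let $L_p(\Omega)$ be the space of real functions on $\Omega$ with respect to Lebesgue measure. For a Banach space $X$, a set $K\subset X$ and $n\ge 1$, the manifold $n$-width of $K$ is $$\delta_n(K)_X=\inf_{a,M}\ \sup_{f\in K}\|f-M(a(f))\|_X,$$ where the infimum is over all continuous maps $a:K\to\mathbb R^n$ and $M:\mathbb R^n\to X$ ($K$ carries the topology of $X$). For $f\in L_q(\Omega)$ and an integer $k\ge 1$ put $\Delta_h^kf(x)=\sum_{j=0}^k(-1)^j\binom kj f(x+jh)$, $\Omega_{kh}=\{x\in\Omega: x+kh\in\Omega\}$ and $\omega_k(f,t)_q=\sup_{h\in\mathbb R^d,\,|h|\le t}\|\Delta_h^kf\|_{L_q(\Omega_{kh})}$. For real $s>0$ and $1\le r\le\infty$, fix an integer $k>s$ and put $\|f\|_{B^s_r(L_q(\Omega))}=\|f\|_{L_q(\Omega)}+|f|_{B^s_r(L_q(\Omega))}$, where $$|f|_{B^s_r(L_q(\Omega))}=\Big(\int_0^\infty \frac{\omega_k(f,t)_q^r}{t^{sr+1}}\,dt\Big)^{1/r}\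 (r<\infty),\qquad |f|_{B^s_\infty(L_q(\Omega))}=\sup_{t>0}t^{-s}\omega_k(f,t)_q .$$ Let $\mathcal B^s_{r,q}$ be the set of $f\in L_q(\Omega)$ with $\|f\|_{B^s_r(L_q(\Omega))}\le 1$. For an integer $s\ge 1$ let $\mathcal F^s_q$ be the set of $f\in L_q(\Omega)$ whose tensor $f^{(s)}$ of weak derivatives of order $s$ on the interior of $\Omega$ lies in $L_q(\Omega)$ (with the Euclidean norm on tensors) and which satisfy $\|f\|_{L_q(\Omega)}+\|f^{(s)}\|_{L_q(\Omega)}\le 1$. Theorem. 1. (Besov balls) Let $s>0$ be real with $\frac1q-\frac1p<\frac sd$ (the condition under which these balls embed compactly into $L_p(\Omega)$), and let $k>s$ be the integer used in the definition of the Besov norms. Then there is a constant $C>0$, depending only on $s,d,p,q$ and the choice of $k$, such that for all $1\le r\le\infty$ and all integers $n\ge 1$ $$\delta_n(\mathcal B^s_{r,q})_{L_p(\Omega)}\ \ge\ C\,n^{-s/d}.$$ 2. (Sobolev balls) Let $s\ge 1$ be an integer with $\frac1q-\frac1p<\frac sd$. Then there is a constant $C>0$, depending only on $s,d,p,q$,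 such that for all integers $n\ge 1$ $$\delta_n(\mathcal F^s_q)_{L_p(\Omega)}\ \ge\ C\,n^{-s/d}.$$ -/

import Mathlib

open MeasureTheory Set
open scoped ENNReal

/-- The cube `[0,1]^d` in Euclidean space `ℝ^d`. -/
def unitCube (d : ℕ) : Set (EuclideanSpace ℝ (Fin d)) :=
  {x | ∀ i, x i ∈ Icc (0 : ℝ) 1}

/-- Lebesgue measure on the cube; `L_p(Ω)` is `Lp ℝ p (cubeMeasure d)`. -/
noncomputable def cubeMeasure (d : ℕ) : Measure (EuclideanSpace ℝ (Fin d)) :=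
  volume.restrict (unitCube d)

/-- The manifold `n`-width `δ_n(K)_X`: the infimum over all continuous encoders `a : K → ℝ^n` and
continuous decoders `M : ℝ^n → X` of the worst-case error `sup_{f ∈ K} ‖f - M (a f)‖`. -/
noncomputable def manifoldWidth {X : Type*} [NormedAddCommGroup X] (n : ℕ) (K : Set X) : ℝ≥0∞ :=
  ⨅ (a : C(K, EuclideanSpace ℝ (Fin n))) (M : C(EuclideanSpace ℝ (Fin n), X)),
    ⨆ f : K, ‖(f : X) - M (a f)‖ₑ

/-- The `k`-th order finite difference `Δ_h^k f(x) = ∑_{j=0}^k (-1)^j (k choose j) f(x + j h)`. -/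
noncomputable def finiteDiff {d : ℕ} (k : ℕ) (h : EuclideanSpace ℝ (Fin d))
    (f : EuclideanSpace ℝ (Fin d) → ℝ) (x : EuclideanSpace ℝ (Fin d)) : ℝ :=
  ∑ j ∈ Finset.range (k + 1), (-1 : ℝ) ^ j * (k.choose j : ℝ) * f (x + (j : ℝ) • h)

/-- The set `Ω_{kh} = {x ∈ Ω : x + k h ∈ Ω}`; as the cube is convex, all the points
`x + j h`, `0 ≤ j ≤ k`, lie in the cube for `x` in this set. -/
def cubeShift (d k : ℕ) (h : EuclideanSpace ℝ (Fin d)) : Set (EuclideanSpace ℝ (Fin d)) :=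
  {x | x ∈ unitCube d ∧ x + (k : ℝ) • h ∈ unitCube d}

/-- The modulus of smoothness `ω_k(f,t)_q = sup_{|h| ≤ t} ‖Δ_h^k f‖_{L_q(Ω_{kh})}`. -/
noncomputable def modulusOfSmoothness {d : ℕ} (k : ℕ) (q : ℝ≥0∞)
    (f : EuclideanSpace ℝ (Fin d) → ℝ) (t : ℝ) : ℝ≥0∞ :=
  ⨆ (h : EuclideanSpace ℝ (Fin d)) (_ : ‖h‖ ≤ t),
    eLpNorm (finiteDiff k h f) q (volume.restrict (cubeShift d k h))

/-- The Besov semi-norm `|f|_{B^s_r(L_q(Ω))}`, computed with the `k`-th modulus of smoothness. -/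
noncomputable def besovSeminorm {d : ℕ} (k : ℕ) (s : ℝ) (r q : ℝ≥0∞)
    (f : EuclideanSpace ℝ (Fin d) → ℝ) : ℝ≥0∞ :=
  if r = ∞ then
    ⨆ (t : ℝ) (_ : 0 < t), ENNReal.ofReal (t ^ (-s)) * modulusOfSmoothness k q f t
  else
    (∫⁻ t in Ioi (0 : ℝ),
      modulusOfSmoothness k q f t ^ r.toReal / ENNReal.ofReal (t ^ (s * r.toReal + 1))) ^
        (1 / r.toReal)

/-- The Besov norm `‖f‖_{L_q(Ω)} + |f|_{B^s_r(L_q(Ω))}`. -/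
noncomputable def besovNorm {d : ℕ} (k : ℕ) (s : ℝ) (r q : ℝ≥0∞)
    (f : EuclideanSpace ℝ (Fin d) → ℝ) : ℝ≥0∞ :=
  eLpNorm f q (cubeMeasure d) + besovSeminorm k s r q f

/-- The unit ball of the Besov space `B^s_r(L_q(Ω))`, as a set of elements of `L_p(Ω)`. -/
def besovBall (d k : ℕ) (s : ℝ) (r q p : ℝ≥0∞) : Set (Lp ℝ p (cubeMeasure d)) :=
  {f | MemLp f q (cubeMeasure d) ∧ besovNorm k s r q f ≤ 1}

/-- `g` is the tensor of the weak derivatives of order `s` of `f` on the open cube: the component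
of `g` with index `(i_1, …, i_s)` is the weak derivative `∂_{i_1} ⋯ ∂_{i_s} f`. The tensor
carries its Euclidean (Frobenius) norm. -/
def IsWeakDerivTensor {d : ℕ} (s : ℕ) (f : EuclideanSpace ℝ (Fin d) → ℝ)
    (g : EuclideanSpace ℝ (Fin d) → EuclideanSpace ℝ (Fin s → Fin d)) : Prop :=
  LocallyIntegrableOn f (interior (unitCube d)) ∧
  LocallyIntegrableOn g (interior (unitCube d)) ∧
  ∀ (i : Fin s → Fin d) (φ : EuclideanSpace ℝ (Fin d) → ℝ),
    ContDiff ℝ ((⊤ : ℕ∞) : WithTop ℕ∞) φ → HasCompactSupport φ → tsupport φ ⊆ interior (unitCube d) →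
    ∫ x in unitCube d,
        f x * iteratedFDeriv ℝ s φ x (fun j => EuclideanSpace.single (i j) (1 : ℝ)) =
      (-1 : ℝ) ^ s * ∫ x in unitCube d, g x i * φ x

/-- The unit ball of the Sobolev space `W^s(L_q(Ω))`, with norm
`‖f‖_{L_q(Ω)} + ‖f^{(s)}‖_{L_q(Ω)}`, as a set of elements of `L_p(Ω)`. -/
def sobolevBall (d s : ℕ) (q p : ℝ≥0∞) : Set (Lp ℝ p (cubeMeasure d)) :=
  {f | MemLp f q (cubeMeasure d) ∧
    ∃ g : EuclideanSpace ℝ (Fin d) → EuclideanSpace ℝ (Fin s → Fin d),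
      IsWeakDerivTensor s f g ∧ MemLp g q (cubeMeasure d) ∧
      eLpNorm f q (cubeMeasure d) + eLpNorm g q (cubeMeasure d) ≤ 1}

/-! The lower bound is topological. If an odd continuous map `Φ` sends `ℝ^(n+1)` into `K`,
Borsuk–Ulam gives a unit vector `y` at which any encoder takes the same value on `Φ y` and `Φ (-y) =
-Φ y`. A decoder then returns one element for both, so one of the two errors is at least `‖Φ y‖`
(`le_manifoldWidth_of_odd`).

To make `‖Φ y‖` large, place disjoint bumps in the cells of a grid with `m ^ d ≥ 2 * n` and use
coefficients in `[-1, 1]`. By `exists_odd_map_cube` these can depend on `y` oddly and continuously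
so that on the sphere at most `n` of them differ from `±1`. At least half of the bumps then have
full height, so the `L_1` norm, and hence the `L_p` norm on a probability space, is bounded below by
a constant times the amplitude. An amplitude of order `m ^ (-s)` puts all these sums in the Besov or
Sobolev ball, and `m` of order `n ^ (1 / d)` gives the rate.

Borsuk–Ulam is proved algebraically. After polynomial approximation, the odd part is written in the
chart `(1, x) / r` of the sphere. A generic system `x i ^ D + t * f i = 0` with `D` odd and `deg f i
≤ D` has a quotient algebra of odd dimension `D ^ n`, hence a real solution; for large `t` the
approximated map is small there. -/

/-! ### Real points of algebras of odd dimension. -/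

/-- Real irreducible factors have degree 1 or 2; splitting off a quadratic one leaves a cofactor of
smaller odd degree. -/
theorem Polynomial.exists_isRoot_of_odd_natDegree_real :
    ∀ (N : ℕ) (P : Polynomial ℝ), P.natDegree = N → Odd N → ∃ x, P.IsRoot x := by
  intro N
  induction N using Nat.strong_induction_on with
  | _ N ih =>
    intro P hP hN
    have hpos : 0 < P.natDegree := hP ▸ hN.pos
    have h0 : P ≠ 0 := fun h => by simp [h] at hpos
    have hu : ¬ IsUnit P := Polynomial.not_isUnit_of_natDegree_pos P hpos
    obtain ⟨g, hg, R, rfl⟩ := WfDvdMonoid.exists_irreducible_factor hu h0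
    have hR : R ≠ 0 := right_ne_zero_of_mul h0
    rw [Polynomial.natDegree_mul hg.ne_zero hR] at hP
    have h2 : g.natDegree ≤ 2 := Polynomial.natDegree_le_of_degree_le hg.degree_le_two
    have h1 : 0 < g.natDegree := hg.natDegree_pos
    rcases (by omega : g.natDegree = 1 ∨ g.natDegree = 2) with h | h
    · obtain ⟨x, hx⟩ := Polynomial.exists_root_of_degree_eq_one
        ((Polynomial.degree_eq_iff_natDegree_eq_of_pos one_pos).2 h)
      exact ⟨x, Polynomial.root_mul_right_of_isRoot _ hx⟩
    · obtain ⟨x, hx⟩ := ih R.natDegree (by omega) R rfl (by rcases hN with ⟨c, hc⟩; exact ⟨c - 1, by omega⟩)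
      exact ⟨x, Polynomial.root_mul_left_of_isRoot _ hx⟩

/-- A commutative real algebra of odd finite dimension has a real point. -/
theorem exists_algHom_real_of_odd_finrank :
    ∀ (N : ℕ) (A : Type*) [CommRing A] [Algebra ℝ A] [FiniteDimensional ℝ A],
      Module.finrank ℝ A = N → Odd N → Nonempty (A →ₐ[ℝ] ℝ) := by
  intro N
  induction N using Nat.strong_induction_on with
  | _ N ih =>
    intro A _ _ _ hA hN
    have hnt : Nontrivial A := Module.nontrivial_of_finrank_pos (R := ℝ) (hA ▸ hN.pos)
    by_cases hsc : Function.Surjective (algebraMap ℝ A)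
    · exact ⟨(AlgEquiv.ofBijective (Algebra.ofId ℝ A)
        ⟨(algebraMap ℝ A).injective, hsc⟩).symm.toAlgHom⟩
    obtain ⟨a, ha⟩ := not_forall.1 hsc
    -- Multiplication by `a` has a characteristic polynomial of odd degree, hence a real eigenvalue
    -- `l`; then `b = a - l` is a nonzero zero divisor.
    obtain ⟨l, hl⟩ := Polynomial.exists_isRoot_of_odd_natDegree_real N
      (LinearMap.charpoly (LinearMap.mulLeft ℝ a)) (by rw [LinearMap.charpoly_natDegree, hA]) hN
    obtain ⟨v, hv⟩ := ((Module.End.hasEigenvalue_iff_isRoot_charpoly _ _).2 hl).exists_hasEigenvector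
    have hv1 : a * v = l • v := by simpa using hv.apply_eq_smul
    set b : A := a - algebraMap ℝ A l with hb
    have hb0 : b ≠ 0 := fun h => ha ⟨l, (sub_eq_zero.1 h).symm⟩
    -- `J` is the annihilator of `b` and `I = (b)`. Both are nonzero and `A ⧸ J ≃ I`, so the
    -- dimensions of `A ⧸ J` and `A ⧸ I` add up to the odd number `N`: one of these smaller
    -- quotients has odd dimension.
    set T := LinearMap.toSpanSingleton A A b with hT
    set J : Ideal A := LinearMap.ker T with hJ
    set I : Ideal A := LinearMap.range T with hI
    have hvJ : v ∈ J := by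
      simp only [hJ, LinearMap.mem_ker, hT, LinearMap.toSpanSingleton_apply, smul_eq_mul, hb]
      rw [mul_comm, sub_mul, hv1, Algebra.smul_def, sub_self]
    have hbI : b ∈ I := ⟨1, by simp [hT]⟩
    have key (K : Ideal A) : Module.finrank ℝ (A ⧸ K) + Module.finrank ℝ K = N := by
      rw [← hA, ← Submodule.finrank_quotient_add_finrank (K.restrictScalars ℝ)]
      exact congrArg₂ (· + ·)
        (LinearEquiv.finrank_eq (Submodule.Quotient.restrictScalarsEquiv ℝ K)).symm rfl
    have hJI : Module.finrank ℝ (A ⧸ J) = Module.finrank ℝ I :=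
      LinearEquiv.finrank_eq (T.quotKerEquivRange.restrictScalars ℝ)
    have pos (K : Ideal A) (x : A) (hx : x ≠ 0) (hxK : x ∈ K) : 0 < Module.finrank ℝ K := by
      have : Nontrivial K := ⟨⟨⟨x, hxK⟩, 0, fun h => hx (congrArg Subtype.val h)⟩⟩
      have : FiniteDimensional ℝ K :=
        inferInstanceAs (FiniteDimensional ℝ (K.restrictScalars ℝ))
      exact Module.finrank_pos
    have h1 := pos J v hv.2 hvJ
    have h2 := pos I b hb0 hbI
    have k1 := key J
    have k2 := key I
    have lift (K : Ideal A) (hK : 0 < Module.finrank ℝ K)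
        (hodd : Odd (Module.finrank ℝ (A ⧸ K))) : Nonempty (A →ₐ[ℝ] ℝ) := by
      have : FiniteDimensional ℝ (A ⧸ K) :=
        Module.Finite.of_surjective (Ideal.Quotient.mkₐ ℝ K).toLinearMap
          (Ideal.Quotient.mkₐ_surjective ℝ K)
      obtain ⟨g⟩ := ih _ (by have := key K; omega) (A ⧸ K) rfl hodd
      exact ⟨g.comp (Ideal.Quotient.mkₐ ℝ K)⟩
    by_cases hodd : Odd (Module.finrank ℝ (A ⧸ J))
    · exact lift J h1 hodd
    · refine lift I h2 ?_
      rw [Nat.not_odd_iff_even] at hodd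
      rw [Nat.odd_iff] at hN ⊢
      rw [Nat.even_iff] at hodd
      omega

/-! ### Perturbed powers: dimension of the quotient and common real zeros. -/

section MixedMonomial

open MvPolynomial

variable {n : ℕ} {S : Type*} [CommRing S]

/-- The monomial with exponent `α` in which every full power `X i ^ D` is replaced by `g i`. -/
noncomputable def mixedMonomial (D : ℕ) (g : Fin n → MvPolynomial (Fin n) S) (α : Fin n →₀ ℕ) :
    MvPolynomial (Fin n) S :=
  ∏ i, (X i ^ (α i % D) * g i ^ (α i / D))

/-- Multiplication by products of the `g i` only shifts exponents by multiples of `D`. This makes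
mixed monomials a basis adapted to the ideal generated by the `g i`. -/
theorem mixedMonomial_add_smul {D : ℕ} (hD : 0 < D) (g : Fin n → MvPolynomial (Fin n) S)
    (α β : Fin n →₀ ℕ) :
    mixedMonomial D g (α + D • β) = mixedMonomial D g α * ∏ i, g i ^ β i := by
  simp only [mixedMonomial, ← Finset.prod_mul_distrib]
  refine Finset.prod_congr rfl fun i _ => ?_
  simp [Nat.add_mul_mod_self_left, Nat.add_mul_div_left _ _ hD, pow_add, mul_assoc]

theorem monomial_one_eq_prod (α : Fin n →₀ ℕ) :
    (monomial α (1 : S)) = ∏ i, X i ^ α i := by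
  rw [monomial_eq, C_1, one_mul, Finsupp.prod_fintype _ _ (by simp)]

theorem mixedMonomial_of_lt {D : ℕ} (g : Fin n → MvPolynomial (Fin n) S) {α : Fin n →₀ ℕ}
    (h : ∀ i, α i < D) : mixedMonomial D g α = monomial α 1 := by
  rw [monomial_one_eq_prod]
  refine Finset.prod_congr rfl fun i _ => ?_
  rw [Nat.mod_eq_of_lt (h i), Nat.div_eq_of_lt (h i), pow_zero, mul_one]

theorem mixedMonomial_X_pow (D : ℕ) (α : Fin n →₀ ℕ) :
    mixedMonomial D (fun i => (X i ^ D : MvPolynomial (Fin n) S)) α = monomial α 1 := by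
  rw [monomial_one_eq_prod]
  refine Finset.prod_congr rfl fun i _ => ?_
  rw [← pow_mul, ← pow_add, Nat.mod_add_div]

theorem totalDegree_mixedMonomial_le [Nontrivial S] {D : ℕ} {g : Fin n → MvPolynomial (Fin n) S}
    (hg : ∀ i, (g i).totalDegree ≤ D) (α : Fin n →₀ ℕ) :
    (mixedMonomial D g α).totalDegree ≤ α.degree := by
  rw [Finsupp.degree_eq_sum]
  refine (totalDegree_finsetProd _ _).trans (Finset.sum_le_sum fun i _ => ?_)
  refine (totalDegree_mul _ _).trans ?_
  refine (add_le_add (totalDegree_X_pow (R := S) i _).le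
    ((totalDegree_pow _ _).trans (Nat.mul_le_mul_left _ (hg i)))).trans ?_
  rw [Nat.mul_comm, Nat.mod_add_div]

theorem map_mixedMonomial {S' : Type*} [CommRing S'] (φ : S →+* S') (D : ℕ)
    (g : Fin n → MvPolynomial (Fin n) S) (α : Fin n →₀ ℕ) :
    map φ (mixedMonomial D g α) = mixedMonomial D (fun i => map φ (g i)) α := by
  simp [mixedMonomial, map_prod]

theorem coeff_eq_zero_of_totalDegree_lt_degree {p : MvPolynomial (Fin n) S} {β : Fin n →₀ ℕ}
    (h : p.totalDegree < β.degree) : coeff β p = 0 := by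
  by_contra hc
  exact absurd (le_totalDegree (mem_support_iff.2 hc)) (not_le.2 h)

/-- Generic perturbations of the powers `X i ^ D` still span in every fixed degree. -/
theorem eventually_monomial_mem_span_mixedMonomial {D : ℕ}
    {f : Fin n → MvPolynomial (Fin n) ℝ} (hf : ∀ i, (f i).totalDegree ≤ D) (m : ℕ) :
    ∀ᶠ t : ℝ in Filter.cofinite, ∀ β : Fin n →₀ ℕ, β.degree ≤ m →
      monomial β (1 : ℝ) ∈ Submodule.span ℝ
        (mixedMonomial D (fun i => X i ^ D + C t * f i) '' {α | α.degree ≤ m}) := by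
  classical
  have hfin := Finsupp.finite_of_degree_le (σ := Fin n) m
  let s : Finset (Fin n →₀ ℕ) := hfin.toFinset
  have hs (α) : α ∈ s ↔ α.degree ≤ m := by simp [s]
  -- With `t` as an indeterminate, the coefficient matrix of the mixed monomials has a polynomial
  -- determinant. At `t = 0` the matrix is the identity, so the determinant has finitely many roots.
  let gp : Fin n → MvPolynomial (Fin n) (Polynomial ℝ) := fun i =>
    X i ^ D + C Polynomial.X * map Polynomial.C (f i)
  let Mp : Matrix s s (Polynomial ℝ) := fun α β => coeff β.1 (mixedMonomial D gp α.1)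
  let M : ℝ → Matrix s s ℝ := fun t α β =>
    coeff β.1 (mixedMonomial D (fun i => X i ^ D + C t * f i) α.1)
  have hM (t : ℝ) : (Polynomial.evalRingHom t).mapMatrix Mp = M t := by
    ext α β
    change Polynomial.evalRingHom t (coeff β.1 (mixedMonomial D gp α.1)) =
      coeff β.1 (mixedMonomial D (fun i => X i ^ D + C t * f i) α.1)
    rw [← coeff_map, map_mixedMonomial]
    congr 2
    funext i
    have : (Polynomial.evalRingHom t).comp Polynomial.C = RingHom.id ℝ := by ext; simp
    simp only [gp, map_add, map_mul, map_pow, map_X, map_C, map_map, this, map_id]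
    simp
  have hM0 : M 0 = 1 := by
    ext α β
    simp only [M, C_0, zero_mul, add_zero, mixedMonomial_X_pow, coeff_monomial, Matrix.one_apply,
      Subtype.ext_iff]
  have hdet (t : ℝ) : Mp.det.eval t = (M t).det := by
    rw [← hM, ← RingHom.map_det]; rfl
  have hne : Mp.det ≠ 0 := by
    intro h
    have := hdet 0
    rw [h, hM0] at this
    simp at this
  have hroot : {t : ℝ | Mp.det.IsRoot t}.Finite := Polynomial.finite_setOfPred_isRoot hne
  filter_upwards [hroot.compl_mem_cofinite] with t ht β hβ
  have hunit : IsUnit (M t).det := by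
    rw [← hdet]; exact isUnit_iff_ne_zero.2 ht
  have hdeg : ∀ i, (X i ^ D + C t * f i).totalDegree ≤ D := fun i => by
    refine (totalDegree_add _ _).trans (max_le (totalDegree_X_pow i D).le ?_)
    rw [C_mul']
    exact (totalDegree_smul_le _ _).trans (hf i)
  set E := mixedMonomial D (fun i => X i ^ D + C t * f i) with hE
  have hexp (α : s) : E α.1 = ∑ γ : s, M t α γ • monomial γ.1 (1 : ℝ) := by
    ext δ
    simp only [coeff_sum, coeff_smul, coeff_monomial, smul_eq_mul, mul_ite, mul_one, mul_zero]
    by_cases hδ : δ ∈ s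
    · rw [Finset.sum_eq_single ⟨δ, hδ⟩]
      · simp [M, hE]
      · intro γ _ hγ
        rw [if_neg fun h => hγ (Subtype.ext h)]
      · simp
    · rw [Finset.sum_eq_zero]
      · refine coeff_eq_zero_of_totalDegree_lt_degree
          ((totalDegree_mixedMonomial_le hdeg α.1).trans_lt ?_)
        rw [hs, not_le] at hδ
        exact ((hs _).1 α.2).trans_lt hδ
      · intro γ _
        rw [if_neg]
        rintro rfl
        exact hδ γ.2
  have hinv : monomial β (1 : ℝ) = ∑ α : s, (M t)⁻¹ ⟨β, (hs β).2 hβ⟩ α • E α.1 := by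
    simp_rw [hexp, Finset.smul_sum, smul_smul]
    rw [Finset.sum_comm]
    simp_rw [← Finset.sum_smul, ← Matrix.mul_apply, Matrix.nonsing_inv_mul _ hunit]
    simp [Matrix.one_apply]
  rw [hinv]
  exact Submodule.sum_mem _ fun α _ => Submodule.smul_mem _ _
    (Submodule.subset_span ⟨α.1, (hs _).1 α.2, rfl⟩)

/-- If the mixed monomials span in low degrees, then they span in every degree. -/
theorem monomial_mem_span_mixedMonomial {D : ℕ} (hD : 0 < D)
    {g : Fin n → MvPolynomial (Fin n) ℝ}
    (H : ∀ β : Fin n →₀ ℕ, β.degree ≤ n * (D - 1) + 1 →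
      monomial β (1 : ℝ) ∈ Submodule.span ℝ (mixedMonomial D g '' {α | α.degree ≤ β.degree})) :
    ∀ β : Fin n →₀ ℕ, monomial β (1 : ℝ) ∈
      Submodule.span ℝ (mixedMonomial D g '' {α | α.degree ≤ β.degree}) := by
  have step (N : ℕ) (i : Fin n) (p : MvPolynomial (Fin n) ℝ)
      (hp : p ∈ Submodule.span ℝ (mixedMonomial D g '' {α | α.degree ≤ N})) :
      X i * p ∈ Submodule.span ℝ (mixedMonomial D g '' {α | α.degree ≤ N + 1}) := by
    induction hp using Submodule.span_induction with
    | zero => simp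
    | add x y _ _ hx hy => rw [mul_add]; exact add_mem hx hy
    | smul a x _ hx => rw [mul_smul_comm]; exact Submodule.smul_mem _ _ hx
    | mem x hx =>
      obtain ⟨α, hα, rfl⟩ := hx
      -- The reduced part `γ` has degree at most `n * (D - 1)`, so `X i` times it falls in the range
      -- of `H`. After re-expansion, the factor `∏ j, g j ^ q j` merely shifts exponents.
      let γ : Fin n →₀ ℕ := Finsupp.equivFunOnFinite.symm fun i => α i % D
      let q : Fin n →₀ ℕ := Finsupp.equivFunOnFinite.symm fun i => α i / D
      have hαq : α = γ + D • q := by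
        ext i; simp [γ, q, Nat.mod_add_div]
      have hγ : ∀ i, γ i < D := fun i => Nat.mod_lt _ hD
      have hγd : γ.degree ≤ n * (D - 1) := by
        rw [Finsupp.degree_eq_sum]
        refine (Finset.sum_le_card_nsmul _ _ (D - 1) fun i _ => Nat.le_sub_one_of_lt (hγ i)).trans ?_
        simp
      have hd : (γ + Finsupp.single i 1).degree = γ.degree + 1 := by simp
      have h1 := H (γ + Finsupp.single i 1) (by omega)
      have h2 : X i * mixedMonomial D g α
          = (monomial (γ + Finsupp.single i 1) (1 : ℝ)) * ∏ j, g j ^ q j := by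
        rw [hαq, mixedMonomial_add_smul hD, mixedMonomial_of_lt g hγ, ← mul_assoc, X,
          monomial_mul, one_mul, add_comm]
      rw [h2]
      have hαd : α.degree = γ.degree + D * q.degree := by
        conv_lhs => rw [hαq]
        simp
      rw [hd] at h1
      generalize (monomial (γ + Finsupp.single i 1) (1 : ℝ)) = P at h1
      induction h1 using Submodule.span_induction with
      | zero => simp
      | add x y _ _ hx hy => rw [add_mul]; exact add_mem hx hy
      | smul a x _ hx => rw [smul_mul_assoc]; exact Submodule.smul_mem _ _ hx
      | mem x hx =>
        obtain ⟨δ, hδ, rfl⟩ := hx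
        rw [← mixedMonomial_add_smul hD]
        refine Submodule.subset_span ⟨_, ?_, rfl⟩
        simp only [Set.mem_ofPred_eq, map_add, map_nsmul, smul_eq_mul] at hα hδ ⊢
        omega
  intro β
  induction hN : β.degree generalizing β with
  | zero =>
    have := H β (by omega)
    rwa [hN] at this
  | succ N ih =>
    have hne : ∃ i, β i ≠ 0 := by
      by_contra h
      push Not at h
      have : β = 0 := by ext i; simp [h i]
      simp [this] at hN
    obtain ⟨i, hi⟩ := hne
    have hle : Finsupp.single i 1 ≤ β := by
      rw [Finsupp.single_le_iff]; omega
    have hβ : β = Finsupp.single i 1 + (β - Finsupp.single i 1) := (add_tsub_cancel_of_le hle).symm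
    have hdeg := congrArg Finsupp.degree hβ
    rw [map_add, Finsupp.degree_single, hN] at hdeg
    have h3 := step N i _ (ih (β - Finsupp.single i 1) (by omega))
    rwa [X, monomial_mul, one_mul, ← hβ] at h3

/-- A dimension count: up to degree `m`, the mixed monomials are indexed by the same finite set as
the ordinary monomials, which lie in their span. -/
theorem linearIndependent_mixedMonomial {D : ℕ} {g : Fin n → MvPolynomial (Fin n) ℝ}
    (H : ∀ β : Fin n →₀ ℕ, monomial β (1 : ℝ) ∈
      Submodule.span ℝ (mixedMonomial D g '' {α | α.degree ≤ β.degree})) :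
    LinearIndependent ℝ (mixedMonomial D g) := by
  classical
  have level (m : ℕ) : LinearIndepOn ℝ (mixedMonomial D g) {α : Fin n →₀ ℕ | α.degree ≤ m} := by
    have hfin := Finsupp.finite_of_degree_le (σ := Fin n) m
    have : Fintype {α : Fin n →₀ ℕ | α.degree ≤ m} := hfin.fintype
    rw [LinearIndepOn, linearIndependent_iff_card_eq_finrank_span]
    refine le_antisymm ?_ (finrank_range_le_card _)
    have hmon : LinearIndependent ℝ
        (fun α : {α : Fin n →₀ ℕ | α.degree ≤ m} => monomial α.1 (1 : ℝ)) := by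
      have := (basisMonomials (Fin n) ℝ).linearIndependent.comp
        (Subtype.val : {α : Fin n →₀ ℕ | α.degree ≤ m} → _) Subtype.val_injective
      rw [coe_basisMonomials] at this
      exact this
    rw [← finrank_span_eq_card hmon, Set.finrank]
    have : FiniteDimensional ℝ (Submodule.span ℝ (range
      fun α : {α : Fin n →₀ ℕ | α.degree ≤ m} => mixedMonomial D g α.1)) :=
      FiniteDimensional.span_of_finite ℝ (finite_range _)
    refine Submodule.finrank_mono (Submodule.span_le.2 ?_)
    rintro _ ⟨β, rfl⟩
    refine Submodule.span_mono ?_ (H β.1)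
    rintro _ ⟨α, hα, rfl⟩
    exact ⟨⟨α, show α.degree ≤ m from le_trans (show _ ≤ _ from hα) β.2⟩, rfl⟩
  rw [linearIndependent_iff_finset_linearIndependent]
  intro s
  refine (level (s.sup Finsupp.degree)).mono (t := (s : Set (Fin n →₀ ℕ))) fun α hα => ?_
  exact Finset.le_sup (f := Finsupp.degree) hα

theorem span_mixedMonomial_eq_top {D : ℕ} {g : Fin n → MvPolynomial (Fin n) ℝ}
    (H : ∀ β : Fin n →₀ ℕ, monomial β (1 : ℝ) ∈
      Submodule.span ℝ (mixedMonomial D g '' {α | α.degree ≤ β.degree})) :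
    Submodule.span ℝ (range (mixedMonomial D g)) = ⊤ := by
  rw [eq_top_iff, ← (basisMonomials (Fin n) ℝ).span_eq, Submodule.span_le]
  rintro _ ⟨β, rfl⟩
  rw [coe_basisMonomials]
  exact Submodule.span_mono (image_subset_range _ _) (H β)

theorem ideal_span_eq_span_mixedMonomial {D : ℕ} (hD : 0 < D)
    {g : Fin n → MvPolynomial (Fin n) ℝ}
    (htop : Submodule.span ℝ (range (mixedMonomial D g)) = ⊤) :
    (Ideal.span (range g)).restrictScalars ℝ =
      Submodule.span ℝ (mixedMonomial D g '' {α | ∃ i, D ≤ α i}) := by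
  have hmul (α : Fin n →₀ ℕ) (i : Fin n) :
      mixedMonomial D g α * g i = mixedMonomial D g (α + D • Finsupp.single i 1) := by
    rw [mixedMonomial_add_smul hD, Finset.prod_eq_single i]
    · simp
    · intro j _ hj
      simp [hj.symm]
    · simp
  apply le_antisymm
  · intro p hp
    rw [Submodule.restrictScalars_mem, Ideal.mem_span_range_iff_exists_fun] at hp
    obtain ⟨c, rfl⟩ := hp
    refine Submodule.sum_mem _ fun i _ => ?_
    have hc : c i ∈ Submodule.span ℝ (range (mixedMonomial D g)) := htop ▸ Submodule.mem_top
    generalize c i = p at hc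
    induction hc using Submodule.span_induction with
    | zero => simp
    | add x y _ _ hx hy => rw [add_mul]; exact add_mem hx hy
    | smul a x _ hx => rw [smul_mul_assoc]; exact Submodule.smul_mem _ _ hx
    | mem x hx =>
      obtain ⟨α, rfl⟩ := hx
      rw [hmul]
      exact Submodule.subset_span ⟨_, ⟨i, by simp⟩, rfl⟩
  · rw [Submodule.span_le]
    rintro _ ⟨α, ⟨i, hi⟩, rfl⟩
    have hle : D • Finsupp.single i 1 ≤ α := by
      rw [Finsupp.smul_single, Finsupp.single_le_iff]; simpa using hi
    rw [← tsub_add_cancel_of_le hle, ← hmul]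
    exact Ideal.mul_mem_left _ _ (Ideal.subset_span ⟨i, rfl⟩)

/-- The ideal is spanned by the basis elements having some exponent at least `D`. The remaining
ones, with all exponents below `D`, give a basis of the quotient. -/
theorem finrank_quotient_eq_pow {D : ℕ} (hD : 0 < D) {g : Fin n → MvPolynomial (Fin n) ℝ}
    (H : ∀ β : Fin n →₀ ℕ, monomial β (1 : ℝ) ∈
      Submodule.span ℝ (mixedMonomial D g '' {α | α.degree ≤ β.degree})) :
    Module.finrank ℝ (MvPolynomial (Fin n) ℝ ⧸ Ideal.span (range g)) = D ^ n ∧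
      FiniteDimensional ℝ (MvPolynomial (Fin n) ℝ ⧸ Ideal.span (range g)) := by
  classical
  have hli := linearIndependent_mixedMonomial H
  have htop := span_mixedMonomial_eq_top H
  have hI := ideal_span_eq_span_mixedMonomial hD htop
  set I := Ideal.span (range g)
  set A : Set (Fin n →₀ ℕ) := {α | ∃ i, D ≤ α i}
  have hcompl : IsCompl (I.restrictScalars ℝ) (Submodule.span ℝ (mixedMonomial D g '' Aᶜ)) := by
    rw [hI]
    refine ⟨hli.disjoint_span_image disjoint_compl_right, codisjoint_iff.2 ?_⟩
    rw [← Submodule.span_union, ← image_union, union_compl_self, image_univ, htop]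
  let e : (MvPolynomial (Fin n) ℝ ⧸ I) ≃ₗ[ℝ] Submodule.span ℝ (mixedMonomial D g '' Aᶜ) :=
    (Submodule.Quotient.restrictScalarsEquiv ℝ I).symm.trans
      (Submodule.quotientEquivOfIsCompl _ _ hcompl)
  let eA : (Aᶜ : Set (Fin n →₀ ℕ)) ≃ (Fin n → Fin D) :=
    { toFun := fun α i => ⟨α.1 i, not_le.1 fun h => α.2 ⟨i, h⟩⟩
      invFun := fun u => ⟨Finsupp.equivFunOnFinite.symm fun i => (u i : ℕ), by
        rintro ⟨i, hi⟩
        exact absurd (u i).2 (not_lt.2 hi)⟩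
      left_inv := fun α => by ext i; simp
      right_inv := fun u => by ext i; simp }
  have : Fintype (Aᶜ : Set (Fin n →₀ ℕ)) := Fintype.ofEquiv _ eA.symm
  have hfin : (mixedMonomial D g '' Aᶜ).Finite := (toFinite Aᶜ).image _
  have : FiniteDimensional ℝ (Submodule.span ℝ (mixedMonomial D g '' Aᶜ)) :=
    FiniteDimensional.span_of_finite ℝ hfin
  refine ⟨?_, Module.Finite.equiv e.symm⟩
  rw [e.finrank_eq, image_eq_range, finrank_span_eq_card (b := fun x : (Aᶜ : Set (Fin n →₀ ℕ)) => mixedMonomial D g x)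
      (hli.comp _ Subtype.val_injective), Fintype.card_congr eA]
  simp

/-- A generic perturbation of `X i ^ D`, `D` odd, by polynomials of degree at most `D` has a
common real zero. -/
theorem eventually_exists_common_zero {D : ℕ} (hD : Odd D)
    {f : Fin n → MvPolynomial (Fin n) ℝ} (hf : ∀ i, (f i).totalDegree ≤ D) :
    ∀ᶠ t : ℝ in Filter.cofinite, ∃ x : Fin n → ℝ, ∀ i, x i ^ D + t * eval x (f i) = 0 := by
  have hall := (Filter.eventually_all_finset (Finset.range (n * (D - 1) + 2))).2
    fun m _ => eventually_monomial_mem_span_mixedMonomial hf m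
  filter_upwards [hall] with t ht
  set g : Fin n → MvPolynomial (Fin n) ℝ := fun i => X i ^ D + C t * f i with hg
  have H := monomial_mem_span_mixedMonomial (g := g) hD.pos fun β hβ =>
    ht β.degree (Finset.mem_range.2 (by omega)) β le_rfl
  obtain ⟨hrank, _⟩ := finrank_quotient_eq_pow hD.pos H
  -- An algebra map from the quotient to `ℝ` is a common zero, with the images of the `X i` as
  -- coordinates.
  obtain ⟨φ⟩ := exists_algHom_real_of_odd_finrank _ _ hrank hD.pow
  let ψ : MvPolynomial (Fin n) ℝ →ₐ[ℝ] ℝ := φ.comp (Ideal.Quotient.mkₐ ℝ _)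
  have hψ : ψ = aeval fun i => ψ (X i) := by
    ext i; simp
  refine ⟨fun i => ψ (X i), fun i => ?_⟩
  have h0 : ψ (g i) = 0 := by
    have : Ideal.Quotient.mk (Ideal.span (range g)) (g i) = 0 :=
      Ideal.Quotient.eq_zero_iff_mem.2 (Ideal.subset_span ⟨i, rfl⟩)
    simp [ψ, this]
  rw [hψ] at h0
  simpa [hg, aeval_eq_eval] using h0

end MixedMonomial

/-! ### The Borsuk–Ulam theorem. -/

section BorsukUlam

open MvPolynomial

/-- Even monomials have no odd part. For odd degree `e`, evaluation at `(1, x) / r` produces `r ^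
(-e)`, and `r ^ D * r ^ (-e)` is a power of `r ^ 2 = 1 + ∑ x i ^ 2` because `D - e` is even, hence a
polynomial in `x`. -/
theorem exists_dehomogenized_odd_part_monomial {n D : ℕ} (hD : Odd D) (s : Fin (n + 1) →₀ ℕ)
    (a : ℝ) (hs : s.degree ≤ D) :
    ∃ f : MvPolynomial (Fin n) ℝ, f.totalDegree ≤ D ∧ ∀ (x : Fin n → ℝ) (r : ℝ), 0 < r →
      r ^ 2 = 1 + ∑ i, x i ^ 2 → eval x f = r ^ D *
        ((eval (r⁻¹ • (Fin.cons 1 x : Fin (n + 1) → ℝ)) (monomial s a) -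
          eval (-(r⁻¹ • (Fin.cons 1 x : Fin (n + 1) → ℝ))) (monomial s a)) / 2) := by
  have hprod (y : Fin (n + 1) → ℝ) (b : ℝ) :
      ∏ i, (b * y i) ^ s i = b ^ s.degree * ∏ i, y i ^ s i := by
    simp_rw [mul_pow, Finset.prod_mul_distrib, Finset.prod_pow_eq_pow_sum, Finsupp.degree_eq_sum]
  have heval (y : Fin (n + 1) → ℝ) : eval y (monomial s a) = a * ∏ i, y i ^ s i := by
    rw [eval_monomial, Finsupp.prod_fintype _ _ (by simp)]
  have hneg (y : Fin (n + 1) → ℝ) :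
      eval (-y) (monomial s a) = (-1) ^ s.degree * (a * ∏ i, y i ^ s i) := by
    rw [heval, mul_left_comm, ← hprod]
    simp
  rcases Nat.even_or_odd s.degree with he | ho
  · refine ⟨0, by simp, fun x r _ _ => ?_⟩
    rw [hneg, heval, he.neg_one_pow]
    simp
  · obtain ⟨k, hk⟩ : ∃ k, D = s.degree + 2 * k := by
      rw [Nat.odd_iff] at hD ho
      exact ⟨(D - s.degree) / 2, by omega⟩
    refine ⟨C a * (∏ i, X i ^ s i.succ) * (1 + ∑ i, X i ^ 2) ^ k, ?_, fun x r hr hrx => ?_⟩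
    · have h1 : (∏ i : Fin n, (X i : MvPolynomial (Fin n) ℝ) ^ s i.succ).totalDegree ≤ s.degree := by
        refine (totalDegree_finsetProd _ _).trans ?_
        rw [Finsupp.degree_eq_sum, Fin.sum_univ_succ]
        simp_rw [totalDegree_X_pow]
        exact Nat.le_add_left _ _
      have h2 : (1 + ∑ i : Fin n, (X i : MvPolynomial (Fin n) ℝ) ^ 2).totalDegree ≤ 2 := by
        refine (totalDegree_add _ _).trans (max_le (by simp) ?_)
        exact totalDegree_finsetSum_le fun i _ => (totalDegree_X_pow i 2).le
      refine (totalDegree_mul _ _).trans ?_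
      rw [hk, mul_comm 2 k]
      refine add_le_add ?_ ((totalDegree_pow _ _).trans (Nat.mul_le_mul_left _ h2))
      rw [C_mul']
      exact (totalDegree_smul_le _ _).trans h1
    · rw [hneg, heval, ho.neg_one_pow]
      simp only [Pi.smul_apply, smul_eq_mul]
      rw [hprod, Fin.prod_univ_succ]
      simp only [map_mul, eval_C, map_prod, map_pow, eval_X, map_add, map_one, map_sum,
        Fin.cons_zero, Fin.cons_succ, one_pow, one_mul]
      rw [← hrx, hk, pow_add, ← pow_mul, inv_pow]
      field_simp
      ring

theorem exists_dehomogenized_odd_part {n D : ℕ} (hD : Odd D) (P : MvPolynomial (Fin (n + 1)) ℝ)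
    (hP : P.totalDegree ≤ D) :
    ∃ f : MvPolynomial (Fin n) ℝ, f.totalDegree ≤ D ∧ ∀ (x : Fin n → ℝ) (r : ℝ), 0 < r →
      r ^ 2 = 1 + ∑ i, x i ^ 2 → eval x f = r ^ D *
        ((eval (r⁻¹ • (Fin.cons 1 x : Fin (n + 1) → ℝ)) P -
          eval (-(r⁻¹ • (Fin.cons 1 x : Fin (n + 1) → ℝ))) P) / 2) := by
  have h : ∀ s : P.support, s.1.degree ≤ D := fun s => (le_totalDegree s.2).trans hP
  choose f hf hfe using fun s : P.support =>
    exists_dehomogenized_odd_part_monomial hD s.1 (coeff s.1 P) (h s)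
  refine ⟨∑ s, f s, totalDegree_finsetSum_le fun s _ => hf s, fun x r hr hrx => ?_⟩
  have hsum : P = ∑ s : P.support, monomial s.1 (coeff s.1 P) := by
    rw [Finset.sum_coe_sort P.support fun s => monomial s (coeff s P)]
    exact P.as_sum
  conv_rhs => rw [hsum]
  simp only [map_sum]
  rw [← Finset.sum_sub_distrib, Finset.sum_div, Finset.mul_sum]
  exact Finset.sum_congr rfl fun s _ => hfe s x r hr hrx

theorem isCompact_setOf_sum_sq_eq_one (ι : Type*) [Fintype ι] :
    IsCompact {y : ι → ℝ | ∑ i, y i ^ 2 = 1} := by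
  refine Metric.isCompact_of_isClosed_isBounded
    (isClosed_eq (by fun_prop) continuous_const) ?_
  refine (Metric.isBounded_closedBall (x := (0 : ι → ℝ)) (r := 1)).subset fun y hy => ?_
  rw [mem_closedBall_zero_iff, pi_norm_le_iff_of_nonneg zero_le_one]
  intro i
  rw [Real.norm_eq_abs, ← sq_le_one_iff_abs_le_one, ← show ∑ i, y i ^ 2 = 1 from hy]
  exact Finset.single_le_sum (f := fun i => y i ^ 2) (fun i _ => sq_nonneg _) (Finset.mem_univ i)

theorem exists_mvPolynomial_near {ι : Type*} [Fintype ι] {K : Set (ι → ℝ)} (hK : IsCompact K)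
    {F : (ι → ℝ) → ℝ} (hF : Continuous F) {ε : ℝ} (hε : 0 < ε) :
    ∃ P : MvPolynomial ι ℝ, ∀ y ∈ K, |eval y P - F y| < ε := by
  let coord : ι → C(ι → ℝ, ℝ) := fun i => ⟨fun y => y i, continuous_apply i⟩
  have hsep : (aeval (R := ℝ) coord).range.SeparatesPoints := by
    intro y z hyz
    obtain ⟨i, hi⟩ := Function.ne_iff.1 hyz
    exact ⟨_, ⟨coord i, ⟨X i, by simp⟩, rfl⟩, hi⟩
  obtain ⟨_, ⟨P, rfl⟩, hP⟩ :=
    ContinuousMap.exists_mem_subalgebra_near_continuous_of_isCompact_of_separatesPoints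
      hsep ⟨F, hF⟩ hK hε
  refine ⟨P, fun y hy => ?_⟩
  have heval : (aeval coord P) y = eval y P := by
    clear hP
    induction P using MvPolynomial.induction_on with
    | C a => simp
    | add p q hp hq => simp_all
    | mul_X p i hp => simp_all [coord]
  have := hP y hy
  rw [Real.norm_eq_abs] at this
  simpa [heval] using this

/-- The Borsuk–Ulam theorem: a continuous odd map `ℝ^(n+1) → ℝ^n` has a zero on the sphere. -/
theorem borsuk_ulam {n : ℕ} {G : (Fin (n + 1) → ℝ) → Fin n → ℝ} (hG : Continuous G)
    (hodd : ∀ y, G (-y) = -G y) : ∃ y, ∑ i, y i ^ 2 = 1 ∧ G y = 0 := by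
  by_contra! hne
  have hK := isCompact_setOf_sum_sq_eq_one (Fin (n + 1))
  obtain ⟨c, hc, hcG⟩ := hK.exists_forall_le' hG.norm.continuousOn
    (fun y hy => norm_pos_iff.2 (hne y hy))
  choose P hP using fun i : Fin n =>
    exists_mvPolynomial_near hK (F := fun y => G y i) (by fun_prop) (half_pos hc)
  let D := 2 * (∑ i, (P i).totalDegree) + 1
  have hD : Odd D := ⟨_, rfl⟩
  have hPD (i : Fin n) : (P i).totalDegree ≤ D := by
    have := Finset.single_le_sum (f := fun i => (P i).totalDegree) (fun i _ => Nat.zero_le _)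
      (Finset.mem_univ i)
    simp only [D]
    omega
  choose f hfD hf using fun i => exists_dehomogenized_odd_part hD (P i) (hPD i)
  -- All but finitely many `t` are admissible, so `t` can be taken above `2 / c`.
  obtain ⟨t, ⟨x, hx⟩, ht⟩ := (((eventually_exists_common_zero hD hfD).filter_mono
    Filter.atTop_le_cofinite).and (Filter.eventually_gt_atTop (2 / c))).exists
  have ht0 : 0 < t := lt_trans (by positivity) ht
  have hS : 0 ≤ ∑ i, x i ^ 2 := Finset.sum_nonneg fun i _ => sq_nonneg _
  set r := Real.sqrt (1 + ∑ i, x i ^ 2) with hr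
  have hr2 : r ^ 2 = 1 + ∑ i, x i ^ 2 := Real.sq_sqrt (by positivity)
  have hr0 : 0 < r := Real.sqrt_pos.2 (by positivity)
  set y : Fin (n + 1) → ℝ := r⁻¹ • (Fin.cons 1 x : Fin (n + 1) → ℝ) with hy
  have hyK : ∑ i, y i ^ 2 = 1 := by
    simp only [hy, Pi.smul_apply, smul_eq_mul, mul_pow, ← Finset.mul_sum, Fin.sum_univ_succ,
      Fin.cons_zero, Fin.cons_succ, one_pow]
    rw [← hr2]
    field_simp
  have hyK' : ∑ i, (-y) i ^ 2 = 1 := by simpa using hyK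
  refine absurd (hcG y hyK) (not_le.2 ((pi_norm_lt_iff hc).2 fun i => ?_))
  have h1 := abs_lt.1 (hP i y hyK)
  have h2 := abs_lt.1 (hP i (-y) hyK')
  have hx1 := hx i
  rw [hf i x r hr0 hr2] at hx1
  set Q := (eval y (P i) - eval (-y) (P i)) / 2 with hQ
  have hxr : |x i / r| ≤ 1 := by
    rw [← sq_le_one_iff_abs_le_one, div_pow, hr2, div_le_one (by positivity)]
    have := Finset.single_le_sum (f := fun i => x i ^ 2) (fun i _ => sq_nonneg _)
      (Finset.mem_univ i)
    linarith
  -- Since `|x i / r| ≤ 1`, the odd part `Q` of `P i` at `y` is at most `1 / t < c / 2`. It is also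
  -- within `c / 2` of `G y i` by oddness of `G`, which contradicts `c ≤ ‖G y‖`.
  have hQt : t * Q = -(x i / r) ^ D := by
    rw [div_pow]
    field_simp
    linarith
  have hQle : |Q| < c / 2 := by
    have h3 : t * |Q| ≤ 1 := by
      rw [← abs_of_pos ht0, ← abs_mul, hQt, abs_neg, abs_pow]
      exact pow_le_one₀ (abs_nonneg _) hxr
    rw [div_lt_iff₀ hc] at ht
    by_contra! h4
    nlinarith
  have h5 := abs_lt.1 hQle
  have h6 : G (-y) i = -G y i := by rw [hodd]; rfl
  rw [h6] at h2
  rw [Real.norm_eq_abs, abs_lt]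
  constructor <;> linarith [h1.1, h1.2, h2.1, h2.2, h5.1, h5.2]

end BorsukUlam

/-! ### Odd maps, manifold widths, and odd maps into a cube. -/

/-- A continuous odd map into `K` whose values on the sphere have norm at least `ε` bounds the
manifold width of `K` from below. -/
theorem le_manifoldWidth_of_odd {X : Type*} [NormedAddCommGroup X] [NormedSpace ℝ X] {n : ℕ}
    {K : Set X}
    {Φ : (Fin (n + 1) → ℝ) → X} (hΦ : Continuous Φ) (hodd : ∀ y, Φ (-y) = -Φ y)
    (hK : ∀ y, Φ y ∈ K) {ε : ℝ≥0∞} (hε : ∀ y, ∑ i, y i ^ 2 = 1 → ε ≤ ‖Φ y‖ₑ) :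
    ε ≤ manifoldWidth n K := by
  refine le_iInf fun a => le_iInf fun M => ?_
  let b : (Fin (n + 1) → ℝ) → EuclideanSpace ℝ (Fin n) := fun y => a ⟨Φ y, hK y⟩
  have hb : Continuous b := a.continuous.comp (hΦ.subtype_mk _)
  obtain ⟨y, hy, hy0⟩ := borsuk_ulam (G := fun y i => b y i - b (-y) i)
    (by fun_prop) (fun y => by ext i; simp)
  have hby : b y = b (-y) := by
    ext i; exact sub_eq_zero.1 (congrFun hy0 i)
  have h1 := le_iSup (fun f : K => ‖(f : X) - M (a f)‖ₑ) ⟨Φ y, hK y⟩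
  have h2 := le_iSup (fun f : K => ‖(f : X) - M (a f)‖ₑ) ⟨Φ (-y), hK (-y)⟩
  change ‖Φ y - M (b y)‖ₑ ≤ _ at h1
  change ‖Φ (-y) - M (b (-y))‖ₑ ≤ _ at h2
  rw [← hby, hodd] at h2
  -- The two errors differ by `2 • Φ y`, so they cannot both be shorter than `Φ y`.
  have h3 : ‖Φ y‖ ≤ ‖Φ y - M (b y)‖ ∨ ‖Φ y‖ ≤ ‖-Φ y - M (b y)‖ := by
    by_contra! h
    have h4 := norm_sub_le (Φ y - M (b y)) (-Φ y - M (b y))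
    rw [sub_sub_sub_cancel_right, sub_neg_eq_add, ← two_smul ℝ, norm_smul, Real.norm_two] at h4
    linarith
  rcases h3 with h | h
  · exact (hε y hy).trans ((enorm_le_iff_norm_le.2 h).trans h1)
  · exact (hε y hy).trans ((enorm_le_iff_norm_le.2 h).trans h2)

/-- A nonzero `y` is the coefficient vector of a polynomial of degree at most `n`, which cannot
vanish at `n + 1` distinct nodes (Vandermonde). Compactness of the sphere and finiteness of the
choices of nodes make this quantitative. -/
theorem exists_pos_forall_card_lt {n : ℕ} {J : Type*} [Fintype J] {t : J → ℝ}
    (ht : Function.Injective t) :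
    ∃ ε : ℝ, 0 < ε ∧ ∀ y : Fin (n + 1) → ℝ, ∑ i, y i ^ 2 = 1 →
      (Finset.univ.filter fun j => |∑ i : Fin (n + 1), t j ^ (i : ℕ) * y i| < ε).card ≤ n := by
  have hu (u : Fin (n + 1) ↪ J) : ∃ e > 0, ∀ y ∈ {y : Fin (n + 1) → ℝ | ∑ i, y i ^ 2 = 1},
      e ≤ ∑ k, |∑ i : Fin (n + 1), t (u k) ^ (i : ℕ) * y i| := by
    refine (isCompact_setOf_sum_sq_eq_one (Fin (n + 1))).exists_forall_le'
      (Continuous.continuousOn (by fun_prop)) fun y hy => ?_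
    refine lt_of_le_of_ne (Finset.sum_nonneg fun _ _ => abs_nonneg _) fun h => ?_
    have h0 := (Finset.sum_eq_zero_iff_of_nonneg fun _ _ => abs_nonneg _).1 h.symm
    have hy0 : y = 0 := Matrix.eq_zero_of_forall_index_sum_pow_mul_eq_zero
      (ht.comp u.injective) fun k => abs_eq_zero.1 (h0 k (Finset.mem_univ k))
    simp [hy0] at hy
  choose e he hle using hu
  have hev : ∀ᶠ ε : ℝ in nhdsWithin 0 (Ioi 0), ∀ u, (n + 1) * ε < e u := by
    refine Filter.eventually_all.2 fun u => nhdsWithin_le_nhds ?_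
    have hc : Continuous fun ε : ℝ => (n + 1) * ε := by fun_prop
    exact hc.continuousAt.eventually_lt_const (by simpa using he u)
  obtain ⟨ε, hε, hε0⟩ := (hev.and self_mem_nhdsWithin).exists
  refine ⟨ε, hε0, fun y hy => ?_⟩
  by_contra! hcard
  obtain ⟨u⟩ := Function.Embedding.nonempty_of_card_le
    (α := Fin (n + 1)) (β := Finset.univ.filter fun j => |∑ i : Fin (n + 1), t j ^ (i : ℕ) * y i| < ε)
    (by simpa [Fintype.card_subtype] using hcard)
  have h1 := hle (u.trans (Function.Embedding.subtype _)) y hy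
  have h2 : ∑ k, |∑ i : Fin (n + 1), t (u k) ^ (i : ℕ) * y i| ≤ ∑ _k : Fin (n + 1), ε :=
    Finset.sum_le_sum fun k _ => (Finset.mem_filter.1 (u k).2).2.le
  simp only [Finset.sum_const, Finset.card_univ, Fintype.card_fin, nsmul_eq_mul] at h2
  push_cast at h2
  exact absurd (hε _) (not_lt.2 (h1.trans h2))

/-- An odd map from `ℝ^(n+1)` to the cube `[-1,1]^J`, all of whose values on the sphere have at
most `n` coordinates different from `±1`. -/
theorem exists_odd_map_cube (n : ℕ) (J : Type*) [Fintype J] :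
    ∃ c : (Fin (n + 1) → ℝ) → J → ℝ, Continuous c ∧ (∀ y, c (-y) = -c y) ∧
      (∀ y j, |c y j| ≤ 1) ∧
      ∀ y, ∑ i, y i ^ 2 = 1 → (Fintype.card J : ℝ) - n ≤ ∑ j, |c y j| := by
  classical
  let t : J → ℝ := fun j => (Fintype.equivFin J j : ℕ)
  have ht : Function.Injective t := fun i j h =>
    (Fintype.equivFin J).injective (Fin.ext (Nat.cast_injective h))
  obtain ⟨ε, hε, hcard⟩ := exists_pos_forall_card_lt (n := n) ht
  let P : (Fin (n + 1) → ℝ) → J → ℝ := fun y j => ∑ i : Fin (n + 1), t j ^ (i : ℕ) * y i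
  -- Truncation is odd and sends every value with `|P y j| ≥ ε` to `±1`; on the sphere at most `n`
  -- coordinates escape this.
  refine ⟨fun y j => max (-1) (min 1 (P y j / ε)), by fun_prop, fun y => ?_, fun y j => ?_,
    fun y hy => ?_⟩
  · ext j
    have : P (-y) j = -P y j := by simp [P]
    simp only [Pi.neg_apply, this, neg_div]
    rcases le_total (P y j / ε) (-1) with h | h <;> rcases le_total (P y j / ε) 1 with h' | h' <;>
      simp only [max_def, min_def] <;> split_ifs <;> linarith
  · rw [abs_le]
    exact ⟨le_max_left _ _, max_le (by norm_num) (min_le_left _ _)⟩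
  · have h1 : ∀ j, 1 - (if |P y j| < ε then (1 : ℝ) else 0) ≤ |max (-1) (min 1 (P y j / ε))| := by
      intro j
      split_ifs with h
      · simp
      · rw [not_lt, le_abs] at h
        rcases h with h | h
        · rw [min_eq_left ((one_le_div hε).2 h)]
          norm_num
        · have h2 : P y j / ε ≤ -1 := by rw [div_le_iff₀ hε]; linarith
          rw [max_eq_left ((min_le_right _ _).trans h2)]
          norm_num
    refine le_trans ?_ (Finset.sum_le_sum fun j _ => h1 j)
    rw [Finset.sum_sub_distrib, Finset.sum_ite]
    simp only [Finset.sum_const, Finset.card_univ, nsmul_eq_mul, mul_one, mul_zero, add_zero]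
    have h3 : ((Finset.univ.filter fun j => |P y j| < ε).card : ℝ) ≤ n := by
      exact_mod_cast hcard y hy
    linarith

/-! ### Sums of disjoint bumps on a grid. -/

section Bumps

/-- The open cube `(0,1)^d`. -/
def openUnitCube (d : ℕ) : Set (EuclideanSpace ℝ (Fin d)) :=
  {x | ∀ i, x i ∈ Ioo (0 : ℝ) 1}

theorem isClosed_unitCube (d : ℕ) : IsClosed (unitCube d) := by
  have : unitCube d = ⋂ i, {x | x i ∈ Icc (0 : ℝ) 1} := by ext; simp [unitCube]
  rw [this]
  exact isClosed_iInter fun i => isClosed_Icc.preimage (by fun_prop)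

theorem volume_unitCube (d : ℕ) : volume (unitCube d) = 1 := by
  have h := (EuclideanSpace.volume_preserving_symm_measurableEquiv_toLp (Fin d)).measure_preimage_equiv
    (Icc 0 1)
  rw [Real.volume_Icc_pi] at h
  have hset : unitCube d = (MeasurableEquiv.toLp 2 (Fin d → ℝ)).symm ⁻¹' Icc 0 1 := by
    ext x
    simp [unitCube, Pi.le_def, forall_and]
  rw [hset, h]
  simp

instance (d : ℕ) : IsProbabilityMeasure (cubeMeasure d) :=
  ⟨by rw [cubeMeasure, Measure.restrict_apply_univ, volume_unitCube]⟩

theorem exists_bump_openUnitCube (d : ℕ) : ∃ φ : EuclideanSpace ℝ (Fin d) → ℝ,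
    ContDiff ℝ ((⊤ : ℕ∞) : WithTop ℕ∞) φ ∧ HasCompactSupport φ ∧ tsupport φ ⊆ openUnitCube d ∧
      (∀ x, 0 ≤ φ x) ∧ 0 < ∫ x, φ x := by
  let c : EuclideanSpace ℝ (Fin d) := WithLp.toLp 2 fun _ => 1 / 2
  -- An outer radius below `1 / 2` keeps the closed ball inside the open cube.
  let b : ContDiffBump c := ⟨1 / 4, 1 / 3, by norm_num, by norm_num⟩
  refine ⟨b, b.contDiff, b.hasCompactSupport, ?_, fun x => b.nonneg, b.integral_pos⟩
  rw [b.tsupport_eq]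
  intro x hx i
  rw [mem_closedBall_iff_norm] at hx
  have h1 : |x i - 1 / 2| ≤ 1 / 3 := (PiLp.norm_apply_le (x - c) i).trans hx
  rw [abs_le] at h1
  constructor <;> linarith [h1.1, h1.2]

variable {d : ℕ}

/-- The copy of `φ` living in the cell of index `j` of the grid of mesh `1 / m`. -/
def scaledBump (φ : EuclideanSpace ℝ (Fin d) → ℝ) (m : ℕ) (j : Fin d → Fin m)
    (x : EuclideanSpace ℝ (Fin d)) : ℝ :=
  φ ((m : ℝ) • x - WithLp.toLp 2 fun i => ((j i : ℕ) : ℝ))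

/-- A linear combination of the copies of `φ` in the cells of the grid of mesh `1 / m`. -/
def bumpSum (φ : EuclideanSpace ℝ (Fin d) → ℝ) (m : ℕ) (c : (Fin d → Fin m) → ℝ)
    (x : EuclideanSpace ℝ (Fin d)) : ℝ :=
  ∑ j, c j * scaledBump φ m j x

theorem eq_of_smul_sub_mem_openUnitCube {m : ℕ} {x : EuclideanSpace ℝ (Fin d)}
    {j j' : Fin d → Fin m}
    (h : (m : ℝ) • x - WithLp.toLp 2 (fun i => ((j i : ℕ) : ℝ)) ∈ openUnitCube d)
    (h' : (m : ℝ) • x - WithLp.toLp 2 (fun i => ((j' i : ℕ) : ℝ)) ∈ openUnitCube d) : j = j' := by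
  ext i
  have h1 := h i
  have h2 := h' i
  simp only [PiLp.sub_apply, PiLp.smul_apply, smul_eq_mul, mem_Ioo] at h1 h2
  have h3 : ((j i : ℕ) : ℝ) < (j' i : ℕ) + 1 := by linarith [h1.1, h2.2]
  have h4 : ((j' i : ℕ) : ℝ) < (j i : ℕ) + 1 := by linarith [h2.1, h1.2]
  norm_cast at h3 h4
  omega

theorem mem_unitCube_of_smul_sub_mem_openUnitCube {m : ℕ} {x : EuclideanSpace ℝ (Fin d)}
    {j : Fin d → Fin m}
    (h : (m : ℝ) • x - WithLp.toLp 2 (fun i => ((j i : ℕ) : ℝ)) ∈ openUnitCube d) :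
    x ∈ unitCube d := by
  intro i
  have h1 := h i
  simp only [PiLp.sub_apply, PiLp.smul_apply, smul_eq_mul, mem_Ioo] at h1
  have hj : ((j i : ℕ) : ℝ) + 1 ≤ m := by exact_mod_cast (j i).2
  have hj0 : (0 : ℝ) ≤ (j i : ℕ) := Nat.cast_nonneg _
  have hm : (0 : ℝ) < m := by linarith
  constructor
  · by_contra! h2
    nlinarith
  · by_contra! h2
    nlinarith

theorem sum_le_of_subsingleton_ne_zero {ι : Type*} [Fintype ι] {g : ι → ℝ} {b : ℝ} (hb : 0 ≤ b)
    (hg : ∀ i, g i ≤ b) (hone : ∀ i i', g i ≠ 0 → g i' ≠ 0 → i = i') : ∑ i, g i ≤ b := by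
  by_cases h : ∃ i, g i ≠ 0
  · obtain ⟨i, hi⟩ := h
    rw [Finset.sum_eq_single i (fun i' _ hne => by
      by_contra h0
      exact hne (hone _ _ h0 hi)) (by simp)]
    exact hg i
  · push Not at h
    simpa [h] using hb

variable {φ : EuclideanSpace ℝ (Fin d) → ℝ}

theorem contDiff_scaledBump (hφ : ContDiff ℝ ((⊤ : ℕ∞) : WithTop ℕ∞) φ) (m : ℕ)
    (j : Fin d → Fin m) : ContDiff ℝ ((⊤ : ℕ∞) : WithTop ℕ∞) (scaledBump φ m j) :=
  hφ.comp ((contDiff_id.const_smul (m : ℝ)).sub contDiff_const)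

theorem contDiff_bumpSum (hφ : ContDiff ℝ ((⊤ : ℕ∞) : WithTop ℕ∞) φ) (m : ℕ)
    (c : (Fin d → Fin m) → ℝ) : ContDiff ℝ ((⊤ : ℕ∞) : WithTop ℕ∞) (bumpSum φ m c) :=
  ContDiff.sum fun j _ => contDiff_const.mul (contDiff_scaledBump hφ m j)

theorem iteratedFDeriv_scaledBump (hφ : ContDiff ℝ ((⊤ : ℕ∞) : WithTop ℕ∞) φ) (m k : ℕ)
    (j : Fin d → Fin m) (x : EuclideanSpace ℝ (Fin d)) :
    iteratedFDeriv ℝ k (scaledBump φ m j) x =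
      (iteratedFDeriv ℝ k φ ((m : ℝ) • x - WithLp.toLp 2 fun i =>
        ((j i : ℕ) : ℝ))).compContinuousLinearMap
          fun _ => (m : ℝ) • ContinuousLinearMap.id ℝ (EuclideanSpace ℝ (Fin d)) := by
  have h := ContinuousLinearMap.iteratedFDeriv_comp_right (n := ((⊤ : ℕ∞) : WithTop ℕ∞))
    ((m : ℝ) • ContinuousLinearMap.id ℝ (EuclideanSpace ℝ (Fin d)))
    (f := fun z => φ (z - WithLp.toLp 2 fun i => ((j i : ℕ) : ℝ)))
    (hφ.comp (contDiff_id.sub contDiff_const)) x (i := k) (by exact_mod_cast le_top)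
  rw [iteratedFDeriv_comp_sub] at h
  exact h

theorem norm_iteratedFDeriv_scaledBump_le (hφ : ContDiff ℝ ((⊤ : ℕ∞) : WithTop ℕ∞) φ) {k : ℕ}
    {B : ℝ} (hB : ∀ x, ‖iteratedFDeriv ℝ k φ x‖ ≤ B) (m : ℕ)
    (j : Fin d → Fin m) (x : EuclideanSpace ℝ (Fin d)) :
    ‖iteratedFDeriv ℝ k (scaledBump φ m j) x‖ ≤ B * (m : ℝ) ^ k := by
  rw [iteratedFDeriv_scaledBump hφ]
  have h1 : ‖(m : ℝ) • ContinuousLinearMap.id ℝ (EuclideanSpace ℝ (Fin d))‖ ≤ m := by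
    rw [norm_smul, Real.norm_natCast]
    exact mul_le_of_le_one_right (Nat.cast_nonneg m) ContinuousLinearMap.norm_id_le
  refine (ContinuousMultilinearMap.norm_compContinuousLinearMap_le _ _).trans ?_
  rw [Finset.prod_const, Finset.card_univ, Fintype.card_fin]
  exact mul_le_mul (hB _) (pow_le_pow_left₀ (norm_nonneg _) h1 k) (by positivity)
    ((norm_nonneg _).trans (hB 0))

theorem smul_sub_mem_of_iteratedFDeriv_scaledBump_ne_zero
    (hφ : ContDiff ℝ ((⊤ : ℕ∞) : WithTop ℕ∞) φ) (hs : tsupport φ ⊆ openUnitCube d) {m k : ℕ}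
    {j : Fin d → Fin m} {x : EuclideanSpace ℝ (Fin d)}
    (h : iteratedFDeriv ℝ k (scaledBump φ m j) x ≠ 0) :
    (m : ℝ) • x - WithLp.toLp 2 (fun i => ((j i : ℕ) : ℝ)) ∈ openUnitCube d := by
  rw [iteratedFDeriv_scaledBump hφ] at h
  refine hs (support_iteratedFDeriv_subset (𝕜 := ℝ) k ?_)
  intro h0
  rw [h0] at h
  exact h (by ext; simp)

/-- At each point at most one term is nonzero, so the bound for a single bump holds regardless of
the number of bumps. -/
theorem norm_iteratedFDeriv_bumpSum_le (hφ : ContDiff ℝ ((⊤ : ℕ∞) : WithTop ℕ∞) φ)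
    (hs : tsupport φ ⊆ openUnitCube d) {k : ℕ} {B : ℝ}
    (hB : ∀ x, ‖iteratedFDeriv ℝ k φ x‖ ≤ B) (m : ℕ)
    {c : (Fin d → Fin m) → ℝ} (hc : ∀ j, |c j| ≤ 1) (x : EuclideanSpace ℝ (Fin d)) :
    ‖iteratedFDeriv ℝ k (bumpSum φ m c) x‖ ≤ B * (m : ℝ) ^ k := by
  have hB0 : 0 ≤ B := (norm_nonneg _).trans (hB 0)
  have hcd (j) : ContDiff ℝ k (scaledBump φ m j) :=
    (contDiff_scaledBump hφ m j).of_le (by exact_mod_cast le_top)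
  have h1 : iteratedFDeriv ℝ k (bumpSum φ m c) x =
      ∑ j, c j • iteratedFDeriv ℝ k (scaledBump φ m j) x := by
    have h2 := iteratedFDeriv_sum (𝕜 := ℝ) (u := Finset.univ) (i := k)
      (f := fun j => c j • scaledBump φ m j) fun j _ => (hcd j).const_smul (c j)
    have h3 : bumpSum φ m c = fun x => ∑ j, (c j • scaledBump φ m j) x := rfl
    rw [h3, h2, Finset.sum_apply]
    exact Finset.sum_congr rfl fun j _ => iteratedFDeriv_const_smul_apply (hcd j).contDiffAt
  rw [h1]
  refine (norm_sum_le _ _).trans (sum_le_of_subsingleton_ne_zero (by positivity) ?_ ?_)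
  · intro j
    rw [norm_smul, Real.norm_eq_abs]
    exact (mul_le_of_le_one_left (norm_nonneg _) (hc j)).trans
      (norm_iteratedFDeriv_scaledBump_le hφ hB m j x)
  · intro j j' hj hj'
    rw [norm_ne_zero_iff] at hj hj'
    exact eq_of_smul_sub_mem_openUnitCube
      (smul_sub_mem_of_iteratedFDeriv_scaledBump_ne_zero hφ hs (right_ne_zero_of_smul hj))
      (smul_sub_mem_of_iteratedFDeriv_scaledBump_ne_zero hφ hs (right_ne_zero_of_smul hj'))

theorem smul_sub_mem_of_scaledBump_ne_zero (hs : tsupport φ ⊆ openUnitCube d) {m : ℕ}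
    {j : Fin d → Fin m} {x : EuclideanSpace ℝ (Fin d)} (h : scaledBump φ m j x ≠ 0) :
    (m : ℝ) • x - WithLp.toLp 2 (fun i => ((j i : ℕ) : ℝ)) ∈ openUnitCube d :=
  hs (subset_tsupport φ h)

theorem abs_bumpSum (hs : tsupport φ ⊆ openUnitCube d) (h0 : ∀ x, 0 ≤ φ x) (m : ℕ)
    (c : (Fin d → Fin m) → ℝ) (x : EuclideanSpace ℝ (Fin d)) :
    |bumpSum φ m c x| = ∑ j, |c j| * scaledBump φ m j x := by
  by_cases h : ∃ j, scaledBump φ m j x ≠ 0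
  · obtain ⟨j, hj⟩ := h
    have hz : ∀ j', j' ≠ j → scaledBump φ m j' x = 0 := by
      intro j' hne
      by_contra h'
      exact hne (eq_of_smul_sub_mem_openUnitCube (smul_sub_mem_of_scaledBump_ne_zero hs h')
        (smul_sub_mem_of_scaledBump_ne_zero hs hj))
    rw [bumpSum, Finset.sum_eq_single j (fun j' _ hne => by rw [hz j' hne, mul_zero]) (by simp),
      Finset.sum_eq_single j (fun j' _ hne => by rw [hz j' hne, mul_zero]) (by simp), abs_mul,
      abs_of_nonneg (show 0 ≤ scaledBump φ m j x from h0 _)]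
  · push Not at h
    simp [bumpSum, h]

theorem integral_scaledBump (hs : tsupport φ ⊆ openUnitCube d) (m : ℕ) (j : Fin d → Fin m) :
    ∫ x, scaledBump φ m j x ∂cubeMeasure d = ((m : ℝ) ^ d)⁻¹ * ∫ x, φ x := by
  rw [cubeMeasure, setIntegral_eq_integral_of_forall_compl_eq_zero]
  · have h := Measure.integral_comp_smul (volume : Measure (EuclideanSpace ℝ (Fin d)))
      (fun z => φ (z - WithLp.toLp 2 fun i => ((j i : ℕ) : ℝ))) m
    rw [integral_sub_right_eq_self (μ := volume) φ, finrank_euclideanSpace_fin,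
      abs_of_nonneg (by positivity)] at h
    exact h
  · intro x hx
    by_contra h
    exact hx (mem_unitCube_of_smul_sub_mem_openUnitCube (smul_sub_mem_of_scaledBump_ne_zero hs h))

theorem integral_abs_bumpSum (hφ : Continuous φ) (hc : HasCompactSupport φ)
    (hs : tsupport φ ⊆ openUnitCube d)
    (h0 : ∀ x, 0 ≤ φ x) (m : ℕ) (c : (Fin d → Fin m) → ℝ) :
    ∫ x, |bumpSum φ m c x| ∂cubeMeasure d = ((m : ℝ) ^ d)⁻¹ * (∫ x, φ x) * ∑ j, |c j| := by
  obtain ⟨B, hB⟩ := hc.exists_bound_of_continuous hφ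
  have hint (j : Fin d → Fin m) : Integrable (scaledBump φ m j) (cubeMeasure d) := by
    refine Integrable.of_bound (Continuous.aestronglyMeasurable ?_) B
      (Filter.Eventually.of_forall fun x => hB _)
    exact hφ.comp (by fun_prop)
  simp_rw [abs_bumpSum hs h0]
  rw [integral_finsetSum _ fun j _ => (hint j).const_mul _]
  simp_rw [integral_const_mul, integral_scaledBump hs, Finset.mul_sum]
  exact Finset.sum_congr rfl fun j _ => mul_comm _ _

end Bumps

/-! ### Moduli of smoothness of smooth functions. -/

section FiniteDifferences

variable {d : ℕ}

theorem abs_finiteDiff_eq (k : ℕ) (h : EuclideanSpace ℝ (Fin d))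
    (f : EuclideanSpace ℝ (Fin d) → ℝ) (x : EuclideanSpace ℝ (Fin d)) :
    |finiteDiff k h f x| = |(fwdDiff h)^[k] f x| := by
  have : (fwdDiff h)^[k] f x = (-1) ^ k * finiteDiff k h f x := by
    rw [fwdDiff_iter_eq_sum_shift, finiteDiff, Finset.mul_sum]
    refine Finset.sum_congr rfl fun j hj => ?_
    have hj' : j ≤ k := Nat.lt_succ_iff.1 (Finset.mem_range.1 hj)
    have hsign : (-1 : ℝ) ^ (k - j) = (-1) ^ k * (-1) ^ j := by
      rw [← pow_add, ← Nat.sub_add_cancel hj', Nat.add_sub_cancel, add_assoc, pow_add,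
        ← two_mul j, pow_mul]
      simp
    rw [zsmul_eq_mul, Nat.cast_smul_eq_nsmul]
    push_cast
    rw [hsign]
    ring
  rw [this, abs_mul, abs_pow, abs_neg, abs_one, one_pow, one_mul]

/-- By the mean value inequality, one difference trades one order of derivative for a factor `‖h‖`.
-/
theorem norm_fwdDiff_iterate_le_of_norm_iteratedFDeriv_le {E : Type*} [NormedAddCommGroup E]
    [NormedSpace ℝ E] (h : E) (k : ℕ) : ∀ {f : E → ℝ} {B : ℝ},
    ContDiff ℝ ((⊤ : ℕ∞) : WithTop ℕ∞) f → (∀ x, ‖iteratedFDeriv ℝ k f x‖ ≤ B) →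
      ∀ x, |(fwdDiff h)^[k] f x| ≤ B * ‖h‖ ^ k := by
  induction k with
  | zero =>
    intro f B _ hB x
    simpa using hB x
  | succ k ih =>
    intro f B hf hB x
    have hf' : ContDiff ℝ ((⊤ : ℕ∞) : WithTop ℕ∞) fun z => f (z + h) :=
      hf.comp (contDiff_id.add contDiff_const)
    rw [Function.iterate_succ_apply, pow_succ', ← mul_assoc]
    refine ih (f := fwdDiff h f) (hf'.sub hf) (fun z => ?_) x
    have h1 : iteratedFDeriv ℝ k (fwdDiff h f) z =
        iteratedFDeriv ℝ k f (z + h) - iteratedFDeriv ℝ k f z := by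
      have h2 := iteratedFDeriv_sub_apply (𝕜 := ℝ) (x := z) (i := k)
        (hf'.of_le (by exact_mod_cast le_top)).contDiffAt
        (hf.of_le (by exact_mod_cast le_top)).contDiffAt
      rw [iteratedFDeriv_comp_add_right] at h2
      exact h2
    rw [h1]
    have hdiff : Differentiable ℝ (iteratedFDeriv ℝ k f) :=
      hf.differentiable_iteratedFDeriv (by exact_mod_cast ENat.natCast_lt_top k)
    have h3 := convex_univ.norm_image_sub_le_of_norm_fderiv_le (𝕜 := ℝ)
      (f := iteratedFDeriv ℝ k f) (C := B) (x := z) (y := z + h) (fun w _ => hdiff w)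
      (fun w _ => by rw [norm_fderiv_iteratedFDeriv]; exact hB w) (mem_univ _) (mem_univ _)
    simpa using h3

theorem abs_fwdDiff_iterate_le_two_pow {E : Type*} [AddCommGroup E] (h : E) (k : ℕ) :
    ∀ {f : E → ℝ} {B : ℝ}, (∀ x, |f x| ≤ B) → ∀ x, |(fwdDiff h)^[k] f x| ≤ 2 ^ k * B := by
  induction k with
  | zero => intro f B hB x; simpa using hB x
  | succ k ih =>
    intro f B hB x
    rw [Function.iterate_succ_apply, pow_succ, mul_assoc]
    refine ih (fun z => (abs_sub _ _).trans ?_) x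
    linarith [hB (z + h), hB z]

theorem measurableSet_cubeShift (k : ℕ) (h : EuclideanSpace ℝ (Fin d)) :
    MeasurableSet (cubeShift d k h) := by
  refine ((isClosed_unitCube d).inter ?_).measurableSet
  exact (isClosed_unitCube d).preimage (f := fun x => x + (k : ℝ) • h) (by fun_prop)

theorem add_smul_mem_unitCube {k j : ℕ} (hj : j ≤ k) {h x : EuclideanSpace ℝ (Fin d)}
    (hx : x ∈ cubeShift d k h) : x + (j : ℝ) • h ∈ unitCube d := by
  intro i
  have h1 := hx.1 i
  have h2 := hx.2 i
  simp only [PiLp.add_apply, PiLp.smul_apply, smul_eq_mul, mem_Icc] at h1 h2 ⊢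
  have hj' : (j : ℝ) ≤ k := by exact_mod_cast hj
  have hj0 : (0 : ℝ) ≤ j := Nat.cast_nonneg j
  rcases le_total 0 (h i) with h0 | h0 <;> constructor <;> nlinarith

/-- Elements of `Lp` are known only almost everywhere; translations preserve null sets, and all the
nodes `x + j h` stay in the cube. -/
theorem finiteDiff_ae_eq {f F : EuclideanSpace ℝ (Fin d) → ℝ} (hfF : f =ᵐ[cubeMeasure d] F)
    (k : ℕ) (h : EuclideanSpace ℝ (Fin d)) :
    finiteDiff k h f =ᵐ[volume.restrict (cubeShift d k h)] finiteDiff k h F := by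
  have h0 : ∀ᵐ x : EuclideanSpace ℝ (Fin d), x ∈ unitCube d → f x = F x :=
    (ae_restrict_iff' (isClosed_unitCube d).measurableSet).1 hfF
  have h1 (j : ℕ) : ∀ᵐ x : EuclideanSpace ℝ (Fin d),
      x + (j : ℝ) • h ∈ unitCube d → f (x + (j : ℝ) • h) = F (x + (j : ℝ) • h) :=
    (measurePreserving_add_right volume ((j : ℝ) • h)).quasiMeasurePreserving.ae h0
  refine (ae_restrict_iff' (measurableSet_cubeShift k h)).2 ?_
  filter_upwards [ae_all_iff.2 h1] with x hx hxs
  refine Finset.sum_congr rfl fun j hj => ?_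
  rw [hx j (add_smul_mem_unitCube (Nat.lt_succ_iff.1 (Finset.mem_range.1 hj)) hxs)]

theorem eLpNorm_le_ofReal_of_measure_univ_le_one {α F : Type*} {_ : MeasurableSpace α}
    [NormedAddCommGroup F] {μ : Measure α} (hμ : μ univ ≤ 1) {f : α → F} {q : ℝ≥0∞} {C : ℝ}
    (hC : ∀ᵐ x ∂μ, ‖f x‖ ≤ C) : eLpNorm f q μ ≤ ENNReal.ofReal C := by
  refine (eLpNorm_le_of_ae_bound hC).trans (mul_le_of_le_one_left' ?_)
  exact ENNReal.rpow_le_one hμ (by positivity)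

/-- The sup bound on `F` serves large `t`, the derivative bound small `t`. On a set of measure at
most one, both control every `L_q` norm. -/
theorem modulusOfSmoothness_le {f F : EuclideanSpace ℝ (Fin d) → ℝ}
    (hfF : f =ᵐ[cubeMeasure d] F) (hF : ContDiff ℝ ((⊤ : ℕ∞) : WithTop ℕ∞) F) {k : ℕ}
    {B L : ℝ} (h0 : ∀ x, |F x| ≤ B)
    (hk : ∀ x, ‖iteratedFDeriv ℝ k F x‖ ≤ B * L ^ k) (q : ℝ≥0∞) {t : ℝ} :
    modulusOfSmoothness k q f t ≤ ENNReal.ofReal (2 ^ k * B * min 1 ((L * t) ^ k)) := by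
  refine iSup₂_le fun h hh => ?_
  rw [eLpNorm_congr_ae (finiteDiff_ae_eq hfF k h)]
  refine eLpNorm_le_ofReal_of_measure_univ_le_one ?_ (Filter.Eventually.of_forall fun x => ?_)
  · rw [Measure.restrict_apply_univ, ← volume_unitCube d]
    exact measure_mono fun x hx => hx.1
  · rw [Real.norm_eq_abs, abs_finiteDiff_eq]
    have h1 : |(fwdDiff h)^[k] F x| ≤ 2 ^ k * B := abs_fwdDiff_iterate_le_two_pow h k h0 x
    rcases min_cases 1 ((L * t) ^ k) with ⟨he, -⟩ | ⟨he, -⟩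
    · rw [he, mul_one]; exact h1
    · rw [he, mul_pow, ← mul_assoc, mul_assoc (2 ^ k), mul_assoc]
      have h2 := norm_fwdDiff_iterate_le_of_norm_iteratedFDeriv_le h k hF hk x
      have hBL : 0 ≤ B * L ^ k := (norm_nonneg _).trans (hk 0)
      have h3 : B * L ^ k * ‖h‖ ^ k ≤ B * L ^ k * t ^ k :=
        mul_le_mul_of_nonneg_left (pow_le_pow_left₀ (norm_nonneg _) hh k) hBL
      have h4 : (1 : ℝ) ≤ 2 ^ k := one_le_pow₀ one_le_two
      have h5 : 0 ≤ B * L ^ k * t ^ k := le_trans (by positivity) h3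
      nlinarith

end FiniteDifferences

/-! ### Besov seminorm bounds uniform in `r`. -/

section BesovNorm

theorem lintegral_Ioc_rpow {a c : ℝ} (ha : -1 < a) (hc : 0 ≤ c) :
    ∫⁻ t in Ioc 0 c, ENNReal.ofReal (t ^ a) = ENNReal.ofReal (c ^ (a + 1) / (a + 1)) := by
  have hint : IntegrableOn (fun t : ℝ => t ^ a) (Ioc 0 c) :=
    (intervalIntegrable_iff_integrableOn_Ioc_of_le hc).1 (intervalIntegral.intervalIntegrable_rpow' ha)
  rw [← ofReal_integral_eq_lintegral_ofReal hint, ← intervalIntegral.integral_of_le hc,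
    integral_rpow (Or.inl ha), Real.zero_rpow (by linarith), sub_zero]
  filter_upwards [ae_restrict_mem measurableSet_Ioc] with t ht
  exact Real.rpow_nonneg ht.1.le a

theorem lintegral_Ioi_rpow {a c : ℝ} (ha : a < -1) (hc : 0 < c) :
    ∫⁻ t in Ioi c, ENNReal.ofReal (t ^ a) = ENNReal.ofReal (-c ^ (a + 1) / (a + 1)) := by
  rw [← ofReal_integral_eq_lintegral_ofReal (integrableOn_Ioi_rpow_of_lt ha hc),
    integral_Ioi_rpow_of_lt ha hc]
  filter_upwards [ae_restrict_mem measurableSet_Ioi] with t ht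
  exact Real.rpow_nonneg (hc.trans ht).le a

theorem rpow_neg_mul_min_le {s L t : ℝ} {k : ℕ} (hs : 0 < s) (hk : s < k) (hL : 0 < L)
    (ht : 0 < t) : t ^ (-s) * min 1 ((L * t) ^ k) ≤ L ^ s := by
  have hu : 0 < L * t := mul_pos hL ht
  have h1 : t ^ (-s) = L ^ s * (L * t) ^ (-s) := by
    rw [Real.mul_rpow hL.le ht.le, ← mul_assoc, ← Real.rpow_add hL, add_neg_cancel, Real.rpow_zero,
      one_mul]
  rw [h1, mul_assoc]
  refine mul_le_of_le_one_right (by positivity) ?_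
  rcases le_total (L * t) 1 with h | h
  · refine (mul_le_mul_of_nonneg_left (min_le_right _ _) (by positivity)).trans ?_
    rw [← Real.rpow_natCast, ← Real.rpow_add hu]
    exact Real.rpow_le_one hu.le h (by linarith)
  · refine (mul_le_mul_of_nonneg_left (min_le_left _ _) (by positivity)).trans ?_
    rw [mul_one]
    exact Real.rpow_le_one_of_one_le_of_nonpos h (by linarith)

/-- The integral is split at `t = 1 / L`; the piece near zero converges because `s < k`, the tail
because `0 < s`. Since `ρ ≥ 1`, the factors `1 / ρ` can be dropped. -/
theorem lintegral_rpow_min_div_le {s L A ρ : ℝ} {k : ℕ} (hs : 0 < s) (hk : s < k) (hL : 0 < L)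
    (hA : 0 ≤ A) (hρ : 1 ≤ ρ) :
    ∫⁻ t in Ioi (0 : ℝ), ENNReal.ofReal (A * min 1 ((L * t) ^ k)) ^ ρ /
      ENNReal.ofReal (t ^ (s * ρ + 1)) ≤
        ENNReal.ofReal ((A * L ^ s) ^ ρ * (1 / (k - s) + 1 / s)) := by
  have hρ0 : 0 < ρ := by linarith
  have hks : 0 < k - s := by linarith
  have hLi : 0 < L⁻¹ := inv_pos.2 hL
  have hmin (t : ℝ) (ht : 0 < t) : 0 ≤ min 1 ((L * t) ^ k) := le_min zero_le_one (by positivity)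
  have hpt (t : ℝ) (ht : 0 < t) : ENNReal.ofReal (A * min 1 ((L * t) ^ k)) ^ ρ /
      ENNReal.ofReal (t ^ (s * ρ + 1)) =
        ENNReal.ofReal (A ^ ρ * (min 1 ((L * t) ^ k) ^ ρ * t ^ (-(s * ρ + 1)))) := by
    have h0 := hmin t ht
    rw [ENNReal.ofReal_rpow_of_nonneg (by positivity) hρ0.le, ← ENNReal.ofReal_div_of_pos
      (by positivity), Real.mul_rpow hA h0, Real.rpow_neg ht.le, mul_div_assoc, div_eq_mul_inv]
  have hLpow : (A * L ^ s) ^ ρ = A ^ ρ * L ^ (s * ρ) := by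
    rw [Real.mul_rpow hA (by positivity), ← Real.rpow_mul hL.le]
  have hfirst : ∫⁻ t in Ioc 0 L⁻¹, ENNReal.ofReal (A * min 1 ((L * t) ^ k)) ^ ρ /
      ENNReal.ofReal (t ^ (s * ρ + 1)) ≤ ENNReal.ofReal ((A * L ^ s) ^ ρ * (1 / (k - s))) := by
    have hb : ∀ t ∈ Ioc 0 L⁻¹, ENNReal.ofReal (A * min 1 ((L * t) ^ k)) ^ ρ /
        ENNReal.ofReal (t ^ (s * ρ + 1)) ≤
          ENNReal.ofReal (A ^ ρ * L ^ (k * ρ)) * ENNReal.ofReal (t ^ ((k - s) * ρ - 1)) := by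
      intro t ht
      have h0 := hmin t ht.1
      rw [hpt t ht.1, ← ENNReal.ofReal_mul (by positivity), mul_assoc]
      refine ENNReal.ofReal_le_ofReal (mul_le_mul_of_nonneg_left ?_ (by positivity))
      have h1 : min 1 ((L * t) ^ k) ^ ρ ≤ L ^ (k * ρ) * t ^ (k * ρ) := by
        refine (Real.rpow_le_rpow h0 (min_le_right _ _) hρ0.le).trans_eq ?_
        rw [← Real.rpow_natCast, ← Real.rpow_mul (mul_pos hL ht.1).le,
          Real.mul_rpow hL.le ht.1.le]
      refine (mul_le_mul_of_nonneg_right h1 (Real.rpow_nonneg ht.1.le _)).trans_eq ?_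
      rw [mul_assoc, ← Real.rpow_add ht.1]
      congr 2
      ring
    refine (setLIntegral_mono' measurableSet_Ioc hb).trans ?_
    have hpos : 0 < (k - s) * ρ := by positivity
    rw [lintegral_const_mul' _ _ ENNReal.ofReal_ne_top, lintegral_Ioc_rpow (by linarith) hLi.le,
      ← ENNReal.ofReal_mul (by positivity), sub_add_cancel, hLpow]
    refine ENNReal.ofReal_le_ofReal ?_
    rw [mul_assoc, mul_assoc]
    refine mul_le_mul_of_nonneg_left ?_ (by positivity)
    rw [Real.inv_rpow hL.le, ← Real.rpow_neg hL.le, ← mul_div_assoc, ← Real.rpow_add hL,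
      show k * ρ + -((k - s) * ρ) = s * ρ by ring, mul_one_div]
    refine div_le_div_of_nonneg_left (by positivity) hks ?_
    nlinarith
  have hsecond : ∫⁻ t in Ioi L⁻¹, ENNReal.ofReal (A * min 1 ((L * t) ^ k)) ^ ρ /
      ENNReal.ofReal (t ^ (s * ρ + 1)) ≤ ENNReal.ofReal ((A * L ^ s) ^ ρ * (1 / s)) := by
    have hb : ∀ t ∈ Ioi L⁻¹, ENNReal.ofReal (A * min 1 ((L * t) ^ k)) ^ ρ /
        ENNReal.ofReal (t ^ (s * ρ + 1)) ≤
          ENNReal.ofReal (A ^ ρ) * ENNReal.ofReal (t ^ (-(s * ρ + 1))) := by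
      intro t ht
      have ht0 : 0 < t := hLi.trans ht
      rw [hpt t ht0, ← ENNReal.ofReal_mul (by positivity)]
      refine ENNReal.ofReal_le_ofReal (mul_le_mul_of_nonneg_left ?_ (by positivity))
      exact mul_le_of_le_one_left (by positivity)
        (Real.rpow_le_one (hmin t ht0) (min_le_left _ _) hρ0.le)
    refine (setLIntegral_mono' measurableSet_Ioi hb).trans ?_
    have hpos : 0 < s * ρ := by positivity
    rw [lintegral_const_mul' _ _ ENNReal.ofReal_ne_top, lintegral_Ioi_rpow (by linarith) hLi,
      ← ENNReal.ofReal_mul (by positivity), hLpow, show -(s * ρ + 1) + 1 = -(s * ρ) by ring,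
      neg_div_neg_eq]
    refine ENNReal.ofReal_le_ofReal ?_
    rw [mul_assoc]
    refine mul_le_mul_of_nonneg_left ?_ (by positivity)
    rw [Real.inv_rpow hL.le, Real.rpow_neg hL.le, inv_inv, mul_one_div]
    refine div_le_div_of_nonneg_left (by positivity) hs ?_
    nlinarith
  rw [← Ioc_union_Ioi_eq_Ioi hLi.le, mul_add, ENNReal.ofReal_add (by positivity) (by positivity)]
  exact (lintegral_union_le _ _ _).trans (add_le_add hfirst hsecond)

variable {d : ℕ}

theorem besovSeminorm_le {s L A : ℝ} {k : ℕ} (hs : 0 < s) (hk : s < k) (hL : 0 < L)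
    (hA : 0 ≤ A) {r q : ℝ≥0∞} (hr : 1 ≤ r) {f : EuclideanSpace ℝ (Fin d) → ℝ}
    (hf : ∀ t, modulusOfSmoothness k q f t ≤ ENNReal.ofReal (A * min 1 ((L * t) ^ k))) :
    besovSeminorm k s r q f ≤ ENNReal.ofReal (A * L ^ s * (1 + 1 / (k - s) + 1 / s)) := by
  have hks : 0 < k - s := by linarith
  -- The extra `1` ensures `K ≥ 1`, so `K ≤ K ^ r` and the bound survives the `r`-th root with a
  -- constant independent of `r`.
  set K := 1 + 1 / (k - s) + 1 / s with hK
  have hK1 : 1 ≤ K := by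
    have : 0 < 1 / (k - s) := by positivity
    have : 0 < 1 / s := by positivity
    linarith
  have hK2 : 1 / (k - s) + 1 / s ≤ K := by linarith
  by_cases hri : r = ∞
  · rw [besovSeminorm, if_pos hri]
    refine iSup₂_le fun t ht => ?_
    refine (mul_le_mul_right (hf t) _).trans ?_
    rw [← ENNReal.ofReal_mul (by positivity)]
    refine ENNReal.ofReal_le_ofReal ?_
    calc t ^ (-s) * (A * min 1 ((L * t) ^ k)) = A * (t ^ (-s) * min 1 ((L * t) ^ k)) := by ring
      _ ≤ A * L ^ s := mul_le_mul_of_nonneg_left (rpow_neg_mul_min_le hs hk hL ht) hA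
      _ ≤ A * L ^ s * K := le_mul_of_one_le_right (by positivity) hK1
  · rw [besovSeminorm, if_neg hri]
    have hρ : 1 ≤ r.toReal := by
      rw [← ENNReal.toReal_one]
      exact ENNReal.toReal_mono hri hr
    have hρ0 : 0 < r.toReal := by linarith
    have h1 : ∫⁻ t in Ioi (0 : ℝ), modulusOfSmoothness k q f t ^ r.toReal /
        ENNReal.ofReal (t ^ (s * r.toReal + 1)) ≤
          ENNReal.ofReal ((A * L ^ s * K) ^ r.toReal) := by
      refine (lintegral_mono fun t => ENNReal.div_le_div_right
        (ENNReal.rpow_le_rpow (hf t) hρ0.le) _).trans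
          ((lintegral_rpow_min_div_le hs hk hL hA hρ).trans (ENNReal.ofReal_le_ofReal ?_))
      rw [Real.mul_rpow (x := A * L ^ s) (y := K) (by positivity) (by linarith)]
      refine mul_le_mul_of_nonneg_left (hK2.trans ?_) (by positivity)
      exact Real.self_le_rpow_of_one_le hK1 hρ
    refine (ENNReal.rpow_le_rpow h1 (by positivity)).trans_eq ?_
    have h2 : 0 ≤ A * L ^ s * K := by positivity
    rw [ENNReal.ofReal_rpow_of_nonneg (by positivity) (by positivity), ← Real.rpow_mul h2,
      mul_one_div_cancel hρ0.ne', Real.rpow_one]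

end BesovNorm

/-! ### Smooth functions have weak derivatives. -/

section WeakDerivatives

/-- Integration by parts, one direction at a time. The outermost derivative on `ψ` moves first and
becomes the innermost on `F`, hence `Fin.rev`; symmetry of derivatives is not needed. -/
theorem integral_mul_iteratedFDeriv_eq {E : Type*} [NormedAddCommGroup E] [NormedSpace ℝ E]
    [FiniteDimensional ℝ E] [MeasurableSpace E] [BorelSpace E] {μ : Measure E}
    [μ.IsAddHaarMeasure] {ψ : E → ℝ} (hψ : ContDiff ℝ ((⊤ : ℕ∞) : WithTop ℕ∞) ψ)
    (hc : HasCompactSupport ψ) (s : ℕ) : ∀ {F : E → ℝ},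
      ContDiff ℝ ((⊤ : ℕ∞) : WithTop ℕ∞) F → ∀ v : Fin s → E,
        ∫ x, F x * iteratedFDeriv ℝ s ψ x v ∂μ =
          (-1) ^ s * ∫ x, iteratedFDeriv ℝ s F x (fun j => v (Fin.rev j)) * ψ x ∂μ := by
  induction s with
  | zero => intro F _ v; simp
  | succ s ih =>
    intro F hF v
    have hψs : ContDiff ℝ 1 (iteratedFDeriv ℝ s ψ) := hψ.iteratedFDeriv_right
      (by exact_mod_cast le_top)
    set η : E → ℝ := fun y => iteratedFDeriv ℝ s ψ y (Fin.tail v) with hη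
    have hη1 : ContDiff ℝ 1 η :=
      (ContinuousMultilinearMap.apply ℝ (fun _ : Fin s => E) ℝ (Fin.tail v)).contDiff.comp hψs
    have hηc : HasCompactSupport η :=
      (hc.iteratedFDeriv (𝕜 := ℝ) s).comp_left
        (g := fun T : ContinuousMultilinearMap ℝ (fun _ : Fin s => E) ℝ => T (Fin.tail v)) rfl
    have hF' : ContDiff ℝ ((⊤ : ℕ∞) : WithTop ℕ∞) (fderiv ℝ F) :=
      hF.fderiv_right (by exact_mod_cast le_top)
    have hF'' : ContDiff ℝ ((⊤ : ℕ∞) : WithTop ℕ∞) fun x => fderiv ℝ F x (v 0) :=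
      hF'.clm_apply contDiff_const
    have hleft (x : E) : iteratedFDeriv ℝ (s + 1) ψ x v = fderiv ℝ η x (v 0) := by
      rw [iteratedFDeriv_succ_apply_left, hη,
        fderiv_continuousMultilinear_apply_const_apply (hψs.differentiable one_ne_zero x)]
    have hright (x : E) : iteratedFDeriv ℝ (s + 1) F x (fun j => v (Fin.rev j)) =
        iteratedFDeriv ℝ s (fun x => fderiv ℝ F x (v 0)) x
          (fun j => Fin.tail v (Fin.rev j)) := by
      rw [iteratedFDeriv_succ_apply_right,
        iteratedFDeriv_clm_apply_const_apply hF' (by exact_mod_cast le_top), Fin.rev_last]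
      congr 2
      ext j
      simp [Fin.init, Fin.tail, Fin.rev_castSucc]
    simp_rw [hleft, hright]
    have hηd : Continuous fun x => fderiv ℝ η x (v 0) :=
      (hη1.continuous_fderiv one_ne_zero).clm_apply continuous_const
    rw [integral_mul_fderiv_eq_neg_fderiv_mul_of_integrable, ih hF'' (Fin.tail v), pow_succ]
    · ring
    · exact (hF''.continuous.mul hη1.continuous).integrable_of_hasCompactSupport hηc.mul_left
    · exact (hF.continuous.mul hηd).integrable_of_hasCompactSupport
        (hηc.fderiv_apply (𝕜 := ℝ) (v 0)).mul_left
    · exact (hF.continuous.mul hη1.continuous).integrable_of_hasCompactSupport hηc.mul_left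
    · exact fun x _ => hF.differentiable (by simp) x
    · exact fun x _ => hη1.differentiable one_ne_zero x

variable {d : ℕ}

/-- The tensor of the classical partial derivatives of order `s`. -/
noncomputable def derivTensor (s : ℕ) (F : EuclideanSpace ℝ (Fin d) → ℝ)
    (x : EuclideanSpace ℝ (Fin d)) : EuclideanSpace ℝ (Fin s → Fin d) :=
  WithLp.toLp 2 fun i =>
    iteratedFDeriv ℝ s F x fun j => EuclideanSpace.single (i (Fin.rev j)) (1 : ℝ)

theorem continuous_derivTensor {F : EuclideanSpace ℝ (Fin d) → ℝ}
    (hF : ContDiff ℝ ((⊤ : ℕ∞) : WithTop ℕ∞) F) (s : ℕ) : Continuous (derivTensor s F) := by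
  have h := hF.continuous_iteratedFDeriv (m := s) (by exact_mod_cast le_top)
  refine (PiLp.continuous_toLp 2 _).comp (continuous_pi fun i => ?_)
  exact (ContinuousMultilinearMap.apply ℝ (fun _ : Fin s => EuclideanSpace ℝ (Fin d)) ℝ
    fun j => EuclideanSpace.single (i (Fin.rev j)) (1 : ℝ)).continuous.comp h

theorem norm_derivTensor_le {F : EuclideanSpace ℝ (Fin d) → ℝ} {s : ℕ} {B : ℝ}
    {x : EuclideanSpace ℝ (Fin d)} (hB : ‖iteratedFDeriv ℝ s F x‖ ≤ B) :
    ‖derivTensor s F x‖ ≤ (d : ℝ) ^ s * B := by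
  have hB0 : 0 ≤ B := (norm_nonneg _).trans hB
  have h1 (i : Fin s → Fin d) : ‖derivTensor s F x i‖ ≤ B := by
    refine ((iteratedFDeriv ℝ s F x).le_opNorm _).trans ?_
    simpa using hB
  -- The triangle inequality over the `d ^ s` components gives the crude factor `d ^ s`.
  have h2 : derivTensor s F x = ∑ i, EuclideanSpace.single i (derivTensor s F x i) := by
    ext i
    simp [Pi.single_apply]
  rw [h2]
  refine (norm_sum_le _ _).trans ((Finset.sum_le_sum (g := fun _ => B) fun i _ => ?_).trans_eq ?_)
  · rw [PiLp.norm_single]; exact h1 i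
  · simp

theorem isCompact_unitCube (d : ℕ) : IsCompact (unitCube d) := by
  refine Metric.isCompact_of_isClosed_isBounded (isClosed_unitCube d) ?_
  refine (Metric.isBounded_closedBall (x := (0 : EuclideanSpace ℝ (Fin d)))
    (r := Real.sqrt d)).subset fun x hx => ?_
  rw [mem_closedBall_zero_iff, EuclideanSpace.norm_eq]
  refine Real.sqrt_le_sqrt ((Finset.sum_le_card_nsmul _ _ 1 fun i _ => ?_).trans_eq (by simp))
  rw [Real.norm_eq_abs, sq_le_one_iff_abs_le_one, abs_abs, abs_of_nonneg (hx i).1]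
  exact (hx i).2

theorem isWeakDerivTensor_derivTensor {f F : EuclideanSpace ℝ (Fin d) → ℝ}
    (hfF : f =ᵐ[cubeMeasure d] F) (hF : ContDiff ℝ ((⊤ : ℕ∞) : WithTop ℕ∞) F) (s : ℕ) :
    IsWeakDerivTensor s f (derivTensor s F) := by
  have hFint : IntegrableOn F (unitCube d) :=
    hF.continuous.continuousOn.integrableOn_compact (isCompact_unitCube d)
  have hfint : IntegrableOn f (unitCube d) := Integrable.congr hFint hfF.symm
  refine ⟨(hfint.mono_set interior_subset).locallyIntegrableOn,
    (continuous_derivTensor hF s).locallyIntegrable.locallyIntegrableOn _,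
    fun i ψ hψ hc hs => ?_⟩
  have hout {x : EuclideanSpace ℝ (Fin d)} (hx : x ∉ unitCube d) : x ∉ tsupport ψ :=
    fun h => hx (interior_subset (hs h))
  have h1 : ∫ x in unitCube d, f x *
      iteratedFDeriv ℝ s ψ x (fun j => EuclideanSpace.single (i j) (1 : ℝ)) =
      ∫ x in unitCube d, F x *
        iteratedFDeriv ℝ s ψ x (fun j => EuclideanSpace.single (i j) (1 : ℝ)) := by
    refine integral_congr_ae ?_
    filter_upwards [show f =ᵐ[volume.restrict (unitCube d)] F from hfF] with x hx
    rw [hx]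
  rw [h1, setIntegral_eq_integral_of_forall_compl_eq_zero,
    setIntegral_eq_integral_of_forall_compl_eq_zero, integral_mul_iteratedFDeriv_eq hψ hc s hF]
  · rfl
  · intro x hx
    rw [image_eq_zero_of_notMem_tsupport (hout hx), mul_zero]
  · intro x hx
    have h0 : iteratedFDeriv ℝ s ψ x = 0 := by
      by_contra h
      exact hout hx (support_iteratedFDeriv_subset (𝕜 := ℝ) s h)
    rw [h0]
    simp

end WeakDerivatives

/-! ### Assembly: grid size, normalization and the two balls. -/

section LowerBound

variable {d : ℕ} {φ : EuclideanSpace ℝ (Fin d) → ℝ}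

theorem le_manifoldWidth_of_bumpSum_mem (hφ : ContDiff ℝ ((⊤ : ℕ∞) : WithTop ℕ∞) φ)
    (hc : HasCompactSupport φ) (hs : tsupport φ ⊆ openUnitCube d) (h0 : ∀ x, 0 ≤ φ x)
    {p : ℝ≥0∞} [hp : Fact (1 ≤ p)] {K : Set (Lp ℝ p (cubeMeasure d))} {n m : ℕ} (hm : 0 < m)
    (hnm : 2 * n ≤ m ^ d) {l : ℝ} (hl : 0 ≤ l)
    (hK : ∀ c : (Fin d → Fin m) → ℝ, (∀ j, |c j| ≤ 1) → ∀ f : Lp ℝ p (cubeMeasure d),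
      f =ᵐ[cubeMeasure d] l • bumpSum φ m c → f ∈ K) :
    ENNReal.ofReal (l * (∫ x, φ x) / 2) ≤ manifoldWidth n K := by
  obtain ⟨c, hcc, hodd, hle, hsum⟩ := exists_odd_map_cube n (Fin d → Fin m)
  have hcont (u : (Fin d → Fin m) → ℝ) : Continuous (bumpSum φ m u) :=
    (contDiff_bumpSum hφ m u).continuous
  have hmem (u : (Fin d → Fin m) → ℝ) : MemLp (bumpSum φ m u) p (cubeMeasure d) := by
    obtain ⟨B, hB⟩ := (isCompact_unitCube d).exists_bound_of_continuousOn (hcont u).continuousOn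
    refine MemLp.of_bound (hcont u).aestronglyMeasurable B ?_
    filter_upwards [ae_restrict_mem (isClosed_unitCube d).measurableSet] with x hx
    exact hB x hx
  let T : ((Fin d → Fin m) → ℝ) →ₗ[ℝ] Lp ℝ p (cubeMeasure d) :=
    { toFun := fun u => (hmem u).toLp
      map_add' := fun u v => by
        rw [← MemLp.toLp_add]
        refine MemLp.toLp_congr _ _ (Filter.Eventually.of_forall fun x => ?_)
        simp [bumpSum, add_mul, Finset.sum_add_distrib]
      map_smul' := fun a u => by
        rw [RingHom.id_apply, ← MemLp.toLp_const_smul]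
        refine MemLp.toLp_congr _ _ (Filter.Eventually.of_forall fun x => ?_)
        simp [bumpSum, mul_assoc, Finset.mul_sum] }
  have hT (u : (Fin d → Fin m) → ℝ) : (l • T u : Lp ℝ p (cubeMeasure d))
      =ᵐ[cubeMeasure d] l • bumpSum φ m u := by
    filter_upwards [Lp.coeFn_smul l (T u), (hmem u).coeFn_toLp] with x h1 h2
    rw [h1, Pi.smul_apply, Pi.smul_apply]
    exact congrArg _ h2
  refine le_manifoldWidth_of_odd (Φ := fun y => l • T (c y))
    ((T.continuous_of_finiteDimensional.comp hcc).const_smul l) (fun y => ?_)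
    (fun y => hK (c y) (hle y) _ (hT _)) fun y hy => ?_
  · rw [hodd, map_neg, smul_neg]
  · rw [Lp.enorm_def, eLpNorm_congr_ae (hT (c y))]
    have hint : Integrable (fun x => |bumpSum φ m (c y) x|) (cubeMeasure d) :=
      ((hmem (c y)).integrable hp.out).abs
    have h1 : eLpNorm (l • bumpSum φ m (c y)) 1 (cubeMeasure d) =
        ENNReal.ofReal (l * ∫ x, |bumpSum φ m (c y) x| ∂cubeMeasure d) := by
      rw [eLpNorm_const_smul, eLpNorm_one_eq_lintegral_enorm, ENNReal.ofReal_mul hl,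
        ofReal_integral_eq_lintegral_ofReal hint
          (Filter.Eventually.of_forall fun x => abs_nonneg _), Real.enorm_eq_ofReal hl]
      congr 2
      ext x
      rw [← Real.norm_eq_abs, ofReal_norm]
    -- On a probability space the `L_1` norm bounds the `L_p` norm from below, and for disjoint
    -- bumps it is computed exactly.
    refine le_trans ?_ (h1.symm.trans_le (eLpNorm_le_eLpNorm_of_exponent_le hp.out
      ((hcont (c y)).const_smul l).aestronglyMeasurable))
    refine ENNReal.ofReal_le_ofReal ?_
    rw [integral_abs_bumpSum hφ.continuous hc hs h0, mul_div_assoc]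
    refine mul_le_mul_of_nonneg_left ?_ hl
    have hI : 0 ≤ ∫ x, φ x := integral_nonneg h0
    have h2 := hsum y hy
    have h3 : (Fintype.card (Fin d → Fin m) : ℝ) = (m : ℝ) ^ d := by simp
    have hnm' : 2 * (n : ℝ) ≤ (m : ℝ) ^ d := by exact_mod_cast hnm
    have hmd : 0 < (m : ℝ) ^ d := by positivity
    rw [h3] at h2
    -- From `2 * n ≤ m ^ d`, the coefficient sum is at least `m ^ d - n ≥ m ^ d / 2`.
    calc (∫ x, φ x) / 2 = ((m : ℝ) ^ d)⁻¹ * (∫ x, φ x) * ((m : ℝ) ^ d / 2) := by field_simp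
      _ ≤ _ := mul_le_mul_of_nonneg_left (by linarith) (by positivity)

theorem exists_grid_size {d n : ℕ} (hd : 1 ≤ d) (hn : 1 ≤ n) {s : ℝ} (hs : 0 < s) :
    ∃ m : ℕ, 0 < m ∧ 2 * n ≤ m ^ d ∧ 3 ^ (-s) * (n : ℝ) ^ (-(s / d)) ≤ (m : ℝ) ^ (-s) := by
  have hd0 : (0 : ℝ) < d := by exact_mod_cast hd
  have hn1 : (1 : ℝ) ≤ n := by exact_mod_cast hn
  have hn0 : (0 : ℝ) < n := by linarith
  set x : ℝ := (n : ℝ) ^ (1 / (d : ℝ)) with hx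
  have hx1 : 1 ≤ x := Real.one_le_rpow hn1 (by positivity)
  have hxd : x ^ d = n := by
    rw [hx, ← Real.rpow_natCast, ← Real.rpow_mul hn0.le, one_div_mul_cancel hd0.ne', Real.rpow_one]
  have hle : 2 * x ≤ (⌈2 * x⌉₊ : ℝ) := Nat.le_ceil _
  have hm : (0 : ℝ) < (⌈2 * x⌉₊ : ℝ) := by linarith
  -- With `x = n ^ (1 / d) ≥ 1`, the ceiling lies between `2 * x` and `3 * x`; the latter gives the
  -- factor `3 ^ (-s)`.
  refine ⟨⌈2 * x⌉₊, by exact_mod_cast hm, ?_, ?_⟩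
  · have h1 : 2 * (n : ℝ) ≤ (⌈2 * x⌉₊ : ℝ) ^ d := by
      refine le_trans ?_ (pow_le_pow_left₀ (by positivity) hle d)
      rw [mul_pow, hxd]
      refine mul_le_mul_of_nonneg_right ?_ hn0.le
      calc (2 : ℝ) = 2 ^ 1 := (pow_one 2).symm
        _ ≤ 2 ^ d := pow_le_pow_right₀ one_le_two hd
    exact_mod_cast h1
  · have h2 : (⌈2 * x⌉₊ : ℝ) ≤ 3 * x := by
      have := Nat.ceil_lt_add_one (show 0 ≤ 2 * x by linarith)
      linarith
    refine le_trans (le_of_eq ?_) (Real.rpow_le_rpow_of_nonpos hm h2 (by linarith))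
    rw [Real.mul_rpow (by norm_num) (by linarith), hx, ← Real.rpow_mul hn0.le]
    congr 2
    ring

/-- Rescaled bump sums give the lower bound `n ^ (-s / d)` for the manifold width of every set
that contains them. -/
theorem exists_le_manifoldWidth_of_bumpSum_mem (hd : 1 ≤ d)
    (hφ : ContDiff ℝ ((⊤ : ℕ∞) : WithTop ℕ∞) φ)
    (hc : HasCompactSupport φ) (hs : tsupport φ ⊆ openUnitCube d) (h0 : ∀ x, 0 ≤ φ x)
    {p : ℝ≥0∞} [Fact (1 ≤ p)] {s l : ℝ} (hs0 : 0 < s) (hl : 0 ≤ l)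
    {K : Set (Lp ℝ p (cubeMeasure d))}
    (hK : ∀ m : ℕ, 0 < m → ∀ c : (Fin d → Fin m) → ℝ, (∀ j, |c j| ≤ 1) →
      ∀ f : Lp ℝ p (cubeMeasure d),
        f =ᵐ[cubeMeasure d] (l * (m : ℝ) ^ (-s)) • bumpSum φ m c → f ∈ K) {n : ℕ} (hn : 1 ≤ n) :
    ENNReal.ofReal (l * 3 ^ (-s) * (∫ x, φ x) / 2 * (n : ℝ) ^ (-(s / d))) ≤ manifoldWidth n K := by
  obtain ⟨m, hm, hnm, hle⟩ := exists_grid_size hd hn hs0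
  refine le_trans (ENNReal.ofReal_le_ofReal ?_)
    (le_manifoldWidth_of_bumpSum_mem hφ hc hs h0 hm hnm (by positivity) (hK m hm))
  have hI : 0 ≤ ∫ x, φ x := integral_nonneg h0
  calc l * 3 ^ (-s) * (∫ x, φ x) / 2 * (n : ℝ) ^ (-(s / d))
      = l * (∫ x, φ x) / 2 * (3 ^ (-s) * (n : ℝ) ^ (-(s / d))) := by ring
    _ ≤ l * (∫ x, φ x) / 2 * (m : ℝ) ^ (-s) := mul_le_mul_of_nonneg_left hle (by positivity)
    _ = _ := by ring

theorem exists_bound_iteratedFDeriv (hφ : ContDiff ℝ ((⊤ : ℕ∞) : WithTop ℕ∞) φ)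
    (hc : HasCompactSupport φ) (k : ℕ) :
    ∃ B : ℝ, 0 < B ∧ (∀ x, |φ x| ≤ B) ∧ ∀ x, ‖iteratedFDeriv ℝ k φ x‖ ≤ B := by
  obtain ⟨B, hB⟩ := hc.exists_bound_of_continuous hφ.continuous
  obtain ⟨B', hB'⟩ := (hc.iteratedFDeriv (𝕜 := ℝ) k).exists_bound_of_continuous
    (hφ.continuous_iteratedFDeriv (m := k) (by exact_mod_cast le_top))
  refine ⟨max B B' + 1, ?_, fun x => ?_, fun x => ?_⟩
  · have := (norm_nonneg _).trans (hB 0)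
    have := le_max_left B B'
    linarith
  · have := hB x
    rw [Real.norm_eq_abs] at this
    linarith [le_max_left B B']
  · linarith [hB' x, le_max_right B B']

theorem abs_smul_bumpSum_le (hφ : ContDiff ℝ ((⊤ : ℕ∞) : WithTop ℕ∞) φ)
    (hs : tsupport φ ⊆ openUnitCube d) {B : ℝ} (hB : ∀ x, |φ x| ≤ B) {m : ℕ}
    {c : (Fin d → Fin m) → ℝ} (hc : ∀ j, |c j| ≤ 1) {l : ℝ} (hl : 0 ≤ l)
    (x : EuclideanSpace ℝ (Fin d)) : |(l • bumpSum φ m c) x| ≤ l * B := by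
  have h := norm_iteratedFDeriv_bumpSum_le hφ hs (k := 0) (B := B)
    (fun x => by simpa using hB x) m hc x
  rw [norm_iteratedFDeriv_zero, pow_zero, mul_one, Real.norm_eq_abs] at h
  rw [Pi.smul_apply, smul_eq_mul, abs_mul, abs_of_nonneg hl]
  exact mul_le_mul_of_nonneg_left h hl

theorem norm_iteratedFDeriv_smul_bumpSum_le (hφ : ContDiff ℝ ((⊤ : ℕ∞) : WithTop ℕ∞) φ)
    (hs : tsupport φ ⊆ openUnitCube d) {k : ℕ} {B : ℝ}
    (hB : ∀ x, ‖iteratedFDeriv ℝ k φ x‖ ≤ B) {m : ℕ}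
    {c : (Fin d → Fin m) → ℝ} (hc : ∀ j, |c j| ≤ 1) {l : ℝ} (hl : 0 ≤ l)
    (x : EuclideanSpace ℝ (Fin d)) :
    ‖iteratedFDeriv ℝ k (l • bumpSum φ m c) x‖ ≤ l * B * (m : ℝ) ^ k := by
  rw [iteratedFDeriv_const_smul_apply
    ((contDiff_bumpSum hφ m c).of_le (by exact_mod_cast le_top)).contDiffAt, norm_smul,
    Real.norm_of_nonneg hl, mul_assoc]
  exact mul_le_mul_of_nonneg_left (norm_iteratedFDeriv_bumpSum_le hφ hs hB m hc x) hl

theorem memLp_of_ae_eq_of_abs_le {f F : EuclideanSpace ℝ (Fin d) → ℝ}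
    (hfF : f =ᵐ[cubeMeasure d] F) (hF : Continuous F) {B : ℝ} (hB : ∀ x, |F x| ≤ B) (q : ℝ≥0∞) :
    MemLp f q (cubeMeasure d) ∧ eLpNorm f q (cubeMeasure d) ≤ ENNReal.ofReal B := by
  constructor
  · exact (memLp_congr_ae hfF).2
      (MemLp.of_bound hF.aestronglyMeasurable B (Filter.Eventually.of_forall hB))
  · rw [eLpNorm_congr_ae hfF]
    exact eLpNorm_le_ofReal_of_measure_univ_le_one prob_le_one (Filter.Eventually.of_forall hB)

/-- The normalization shared by both balls: the amplitude `(B * (1 + M))⁻¹ * m ^ (-s)` offsets the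
growth `m ^ s` of the seminorm, whose constant is `M`. -/
theorem inv_mul_rpow_mul_add_le_one {B s M : ℝ} {m : ℕ} (hB : 0 < B) (hs : 0 < s) (hm : 0 < m)
    (hM : 0 ≤ M) : (B * (1 + M))⁻¹ * (m : ℝ) ^ (-s) * B +
      M * ((B * (1 + M))⁻¹ * (m : ℝ) ^ (-s) * B) * (m : ℝ) ^ s ≤ 1 := by
  have hm0 : (0 : ℝ) < m := by exact_mod_cast hm
  have h1 : (m : ℝ) ^ (-s) ≤ 1 :=
    Real.rpow_le_one_of_one_le_of_nonpos (by exact_mod_cast hm) (by linarith)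
  have h2 : (m : ℝ) ^ (-s) * (m : ℝ) ^ s = 1 := by
    rw [← Real.rpow_add hm0, neg_add_cancel, Real.rpow_zero]
  have h3 : (B * (1 + M))⁻¹ * B = (1 + M)⁻¹ := by field_simp
  calc _ = (B * (1 + M))⁻¹ * B * ((m : ℝ) ^ (-s) + M * ((m : ℝ) ^ (-s) * (m : ℝ) ^ s)) := by ring
    _ ≤ (1 + M)⁻¹ * (1 + M) := by
      rw [h3, h2, mul_one]
      exact mul_le_mul_of_nonneg_left (by linarith) (by positivity)
    _ = 1 := inv_mul_cancel₀ (by positivity)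

theorem exists_le_manifoldWidth_besovBall (hd : 1 ≤ d) (p q : ℝ≥0∞) [Fact (1 ≤ p)] {s : ℝ}
    {k : ℕ} (hs0 : 0 < s) (hk : s < k) :
    ∃ C : ℝ, 0 < C ∧ ∀ r : ℝ≥0∞, 1 ≤ r → ∀ n : ℕ, 1 ≤ n →
      ENNReal.ofReal (C * (n : ℝ) ^ (-(s / d))) ≤ manifoldWidth n (besovBall d k s r q p) := by
  obtain ⟨φ, hφ, hc, hs, h0, hI⟩ := exists_bump_openUnitCube d
  obtain ⟨B, hB, hB0, hBk⟩ := exists_bound_iteratedFDeriv hφ hc k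
  have hks : 0 < k - s := by linarith
  set M : ℝ := 2 ^ k * (1 + 1 / (k - s) + 1 / s) with hM
  have hM0 : 0 ≤ M := by positivity
  refine ⟨(B * (1 + M))⁻¹ * 3 ^ (-s) * (∫ x, φ x) / 2, by positivity, fun r hr n hn =>
    exists_le_manifoldWidth_of_bumpSum_mem hd hφ hc hs h0 hs0 (by positivity)
      (fun m hm c hc1 f hf => ?_) hn⟩
  set l : ℝ := (B * (1 + M))⁻¹ * (m : ℝ) ^ (-s) with hl
  have hl0 : 0 ≤ l := by positivity
  have hm0 : (0 : ℝ) < m := by exact_mod_cast hm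
  have hF : ContDiff ℝ ((⊤ : ℕ∞) : WithTop ℕ∞) (l • bumpSum φ m c) :=
    (contDiff_bumpSum hφ m c).const_smul l
  have hFB := abs_smul_bumpSum_le hφ hs hB0 hc1 hl0
  obtain ⟨hmem, hnorm⟩ := memLp_of_ae_eq_of_abs_le hf hF.continuous hFB q
  -- The modulus bound is used with `L = m` and `A = 2 ^ k * (l * B)`, since each derivative of a
  -- bump costs a factor `m`.
  refine ⟨hmem, (add_le_add hnorm (besovSeminorm_le hs0 hk hm0 (by positivity) hr fun t =>
    modulusOfSmoothness_le hf hF hFB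
      (norm_iteratedFDeriv_smul_bumpSum_le hφ hs hBk hc1 hl0) q)).trans ?_⟩
  rw [← ENNReal.ofReal_add (by positivity) (by positivity), ← ENNReal.ofReal_one]
  refine ENNReal.ofReal_le_ofReal (le_trans (le_of_eq ?_)
    (inv_mul_rpow_mul_add_le_one hB hs0 hm hM0))
  rw [← hl, hM]
  ring

theorem exists_le_manifoldWidth_sobolevBall (hd : 1 ≤ d) (p q : ℝ≥0∞) [Fact (1 ≤ p)] {s : ℕ}
    (hs1 : 1 ≤ s) :
    ∃ C : ℝ, 0 < C ∧ ∀ n : ℕ, 1 ≤ n →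
      ENNReal.ofReal (C * (n : ℝ) ^ (-((s : ℝ) / d))) ≤ manifoldWidth n (sobolevBall d s q p) := by
  obtain ⟨φ, hφ, hc, hs, h0, hI⟩ := exists_bump_openUnitCube d
  obtain ⟨B, hB, hB0, hBs⟩ := exists_bound_iteratedFDeriv hφ hc s
  have hs0 : (0 : ℝ) < s := by exact_mod_cast hs1
  set M : ℝ := (d : ℝ) ^ s with hM
  have hM0 : 0 ≤ M := by positivity
  refine ⟨(B * (1 + M))⁻¹ * 3 ^ (-(s : ℝ)) * (∫ x, φ x) / 2, by positivity, fun n hn =>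
    exists_le_manifoldWidth_of_bumpSum_mem hd hφ hc hs h0 hs0 (by positivity)
      (fun m hm c hc1 f hf => ?_) hn⟩
  set l : ℝ := (B * (1 + M))⁻¹ * (m : ℝ) ^ (-(s : ℝ)) with hl
  have hl0 : 0 ≤ l := by positivity
  have hF : ContDiff ℝ ((⊤ : ℕ∞) : WithTop ℕ∞) (l • bumpSum φ m c) :=
    (contDiff_bumpSum hφ m c).const_smul l
  obtain ⟨hmem, hnorm⟩ := memLp_of_ae_eq_of_abs_le hf hF.continuous
    (abs_smul_bumpSum_le hφ hs hB0 hc1 hl0) q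
  have hg (x : EuclideanSpace ℝ (Fin d)) :
      ‖derivTensor s (l • bumpSum φ m c) x‖ ≤ M * (l * B * (m : ℝ) ^ s) :=
    norm_derivTensor_le (norm_iteratedFDeriv_smul_bumpSum_le hφ hs hBs hc1 hl0 x)
  refine ⟨hmem, derivTensor s (l • bumpSum φ m c), isWeakDerivTensor_derivTensor hf hF s,
    MemLp.of_bound (continuous_derivTensor hF s).aestronglyMeasurable _
      (Filter.Eventually.of_forall hg),
    (add_le_add hnorm (eLpNorm_le_ofReal_of_measure_univ_le_one prob_le_one
      (Filter.Eventually.of_forall hg))).trans ?_⟩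
  rw [← ENNReal.ofReal_add (by positivity) (by positivity), ← ENNReal.ofReal_one]
  refine ENNReal.ofReal_le_ofReal (le_trans (le_of_eq ?_)
    (inv_mul_rpow_mul_add_le_one hB hs0 hm hM0))
  rw [← hl, Real.rpow_natCast]
  ring

end LowerBound
theorem mainTheorem1 (d : ℕ) (hd : 1 ≤ d) (p q : ℝ≥0∞) [Fact (1 ≤ p)] (hq : 1 ≤ q) :
    (∀ (s : ℝ) (k : ℕ), 0 < s → s < k → (1 / q).toReal - (1 / p).toReal < s / d →
      ∃ C : ℝ, 0 < C ∧ ∀ r : ℝ≥0∞, 1 ≤ r → ∀ n : ℕ, 1 ≤ n →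
        ENNReal.ofReal (C * (n : ℝ) ^ (-(s / d))) ≤ manifoldWidth n (besovBall d k s r q p)) ∧
    (∀ s : ℕ, 1 ≤ s → (1 / q).toReal - (1 / p).toReal < (s : ℝ) / d →
      ∃ C : ℝ, 0 < C ∧ ∀ n : ℕ, 1 ≤ n →
        ENNReal.ofReal (C * (n : ℝ) ^ (-((s : ℝ) / d))) ≤
          manifoldWidth n (sobolevBall d s q p)) :=
  ⟨fun _ _ hs hk _ => exists_le_manifoldWidth_besovBall hd p q hs hk,
    fun _ hs _ => exists_le_manifoldWidth_sobolevBall hd p q hs⟩
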